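/- A betweenness constraint over a finite variable set $V=\{v_1,\dots,v_n\}$ is a pair $(v_i,\{v_j,v_k\})$ of three distinct variables; it is satisfied by an ordering (bijection) $\alpha:V\to\{1,\dots,n\}$ if $\alpha(v_j)<\alpha(v_i)<\alpha(v_k)$ or $\alpha(v_k)<\alpha(v_i)<\alpha(v_j)$. The parameterized problem Betweenness Above Average (Betweenness-AA) asks: given a finite variable set $V$, a finite multiset $\mathcal C$ of $m$ betweenness constraints over $V$ and an integer $\kappa\ge 0$ (the parameter), is there an ordering of $V$ that satisfies at least $m/3+\kappa$ constraints of $\mathcal C$ (counted with multiplicity)? **Theorem.** Betweenness-AA has a kernel of size $O(\kappa^2)$. That is, there are a constant $c$, a function $f:\mathbb N\to\mathbb N$ and a polynomial-time algorithm (a Turing machine) that maps every instance $(V,\mathcal C,\kappa)$ of Betweenness-AA to an instance $(V',\mathcal C',\kappa')$ of Betweenness-AA such that 1. $(V,\mathcal C,\kappa)$ is a Yes-instance if and only if $(V',\mathcal C',\kappa')$ is a Yes-instance; 2. $\kappa'\le f(\kappa)$; 3. $|V'|+|\mathcal C'|\le c\,\kappa^2$. Here an instance is given to the machine as a string that consists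 of $\kappa$ in binary, the variable set (one symbol per variable, so that $v_i$ is named by its index) and the list of constraints, with the variable indices in unary. -/

import Mathlib

/-- A betweenness constraint `(mid, {left, right})` on the variables `v_0, …, v_{n-1}`
(three distinct variables). -/
structure BetweennessConstraint (n : ℕ) where
  mid : Fin n
  left : Fin n
  right : Fin n
  mid_ne_left : mid ≠ left
  mid_ne_right : mid ≠ right
  left_ne_right : left ≠ right

/-- The ordering `α` puts `mid` strictly between `left` and `right`. -/
def BetweennessConstraint.SatisfiedBy {n : ℕ} (c : BetweennessConstraint n)
    (α : Fin n ≃ Fin n) : Prop :=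
  (α c.left < α c.mid ∧ α c.mid < α c.right) ∨ (α c.right < α c.mid ∧ α c.mid < α c.left)

instance BetweennessConstraint.instDecidableSatisfiedBy {n : ℕ} (c : BetweennessConstraint n)
    (α : Fin n ≃ Fin n) : Decidable (c.SatisfiedBy α) := by
  unfold BetweennessConstraint.SatisfiedBy
  infer_instance

/-- A set of `numVars` variables and a multiset of betweenness constraints, written down as a
list (constraints may be repeated). -/
structure BetweennessInstance where
  numVars : ℕ
  constraints : List (BetweennessConstraint numVars)

namespace BetweennessInstance

/-- The number of constraints, counted with multiplicity, that the ordering `α` satisfies. -/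
def numSatisfied (I : BetweennessInstance) (α : Fin I.numVars ≃ Fin I.numVars) : ℕ :=
  I.constraints.countP (fun c => decide (c.SatisfiedBy α))

/-- The number of variables plus the number of constraints (counted with multiplicity). -/
def size (I : BetweennessInstance) : ℕ :=
  I.numVars + I.constraints.length

end BetweennessInstance

/-- Betweenness Above Average, as the set of its yes-instances `(I, κ)`: some ordering satisfies
at least `m / 3 + κ` of the `m` constraints. -/
def BetweennessAA : Set (BetweennessInstance × ℕ) :=
  {p | ∃ α : Fin p.1.numVars ≃ Fin p.1.numVars,
    (p.1.constraints.length : ℚ) / 3 + (p.2 : ℚ) ≤ (p.1.numSatisfied α : ℚ)}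

/-- The alphabet in which instances are written. -/
inductive InstanceSymbol
  | zero
  | one
  | sep
  deriving DecidableEq

instance InstanceSymbol.instFintype : Fintype InstanceSymbol where
  elems := {InstanceSymbol.zero, InstanceSymbol.one, InstanceSymbol.sep}
  complete := by
    intro x
    cases x <;> decide

namespace InstanceSymbol

/-- A binary digit. -/
def ofBool (b : Bool) : InstanceSymbol :=
  cond b one zero

/-- A number in unary, closed by a separator. -/
def unary (n : ℕ) : List InstanceSymbol :=
  List.replicate n one ++ [sep]

end InstanceSymbol

/-- A constraint is written as the three indices of its variables. -/
def BetweennessConstraint.encode {n : ℕ} (c : BetweennessConstraint n) : List InstanceSymbol :=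
  InstanceSymbol.unary c.mid ++ InstanceSymbol.unary c.left ++ InstanceSymbol.unary c.right

/-- The input string of `(I, κ)`: first `κ` in binary, then the variables (one stroke for each, as
the variable set is listed in the input), then the constraints. -/
def encodeBetweennessAA (p : BetweennessInstance × ℕ) : List InstanceSymbol :=
  (Computability.encodeNat p.2).map InstanceSymbol.ofBool ++ [InstanceSymbol.sep] ++
    InstanceSymbol.unary p.1.numVars ++
    p.1.constraints.flatMap BetweennessConstraint.encode

/-- No two inputs are written in the same way. -/
theorem encodeBetweennessAA_injective : Function.Injective encodeBetweennessAA := by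
  have huna : ∀ (a b : ℕ) (s t : List InstanceSymbol),
      InstanceSymbol.unary a ++ s = InstanceSymbol.unary b ++ t → a = b ∧ s = t := by
    intro a
    induction a with
    | zero =>
      intro b s t h
      cases b with
      | zero => simpa [InstanceSymbol.unary] using h
      | succ b => simp [InstanceSymbol.unary, List.replicate_succ] at h
    | succ a ih =>
      intro b s t h
      cases b with
      | zero => simp [InstanceSymbol.unary, List.replicate_succ] at h
      | succ b =>
        have h' : InstanceSymbol.unary a ++ s = InstanceSymbol.unary b ++ t := by
          simpa [InstanceSymbol.unary, List.replicate_succ] using h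
        obtain ⟨h1, h2⟩ := ih b s t h'
        exact ⟨by rw [h1], h2⟩
  have hbits : ∀ (a b : List Bool) (s t : List InstanceSymbol),
      a.map InstanceSymbol.ofBool ++ [InstanceSymbol.sep] ++ s =
        b.map InstanceSymbol.ofBool ++ [InstanceSymbol.sep] ++ t → a = b ∧ s = t := by
    intro a
    induction a with
    | nil =>
      intro b s t h
      cases b with
      | nil => simpa using h
      | cons x b => cases x <;> simp [InstanceSymbol.ofBool] at h
    | cons x a ih =>
      intro b s t h
      cases b with
      | nil => cases x <;> simp [InstanceSymbol.ofBool] at h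
      | cons y b =>
        have h' : x = y ∧ a.map InstanceSymbol.ofBool ++ [InstanceSymbol.sep] ++ s =
            b.map InstanceSymbol.ofBool ++ [InstanceSymbol.sep] ++ t := by
          cases x <;> cases y <;> simp [InstanceSymbol.ofBool] at h ⊢ <;> exact h
        obtain ⟨h1, h2⟩ := ih b s t h'.2
        exact ⟨by rw [h'.1, h1], h2⟩
  have hcons : ∀ (n : ℕ) (l m : List (BetweennessConstraint n)),
      l.flatMap BetweennessConstraint.encode = m.flatMap BetweennessConstraint.encode →
        l = m := by
    intro n l
    induction l with
    | nil =>
      intro m h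
      cases m with
      | nil => rfl
      | cons d m => simp [BetweennessConstraint.encode, InstanceSymbol.unary] at h
    | cons c l ih =>
      intro m h
      cases m with
      | nil => simp [BetweennessConstraint.encode, InstanceSymbol.unary] at h
      | cons d m =>
        simp only [List.flatMap_cons, BetweennessConstraint.encode, List.append_assoc] at h
        obtain ⟨h1, h⟩ := huna _ _ _ _ h
        obtain ⟨h2, h⟩ := huna _ _ _ _ h
        obtain ⟨h3, h⟩ := huna _ _ _ _ h
        have hcd : c = d := by
          cases c
          cases d
          simp only [BetweennessConstraint.mk.injEq]
          exact ⟨Fin.ext h1, Fin.ext h2, Fin.ext h3⟩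
        rw [hcd, ih m h]
  rintro ⟨⟨n, l⟩, k⟩ ⟨⟨n', l'⟩, k'⟩ h
  simp only [encodeBetweennessAA] at h
  rw [List.append_assoc _ (InstanceSymbol.unary n), List.append_assoc _ (InstanceSymbol.unary n')]
    at h
  obtain ⟨h1, h⟩ := hbits _ _ _ _ h
  obtain ⟨rfl, h⟩ := huna _ _ _ _ h
  have hk : k = k' := by
    simpa using congrArg Computability.decodeNat h1
  rw [hk, hcons _ _ _ h]

/-- `R` is a kernelization of the parameterized problem `P` (a set of pairs of an instance and a
parameter) with bound `f` on the new parameter and size `g`: `R` is computed in polynomial time by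
a Turing machine on the encoded pairs, it preserves membership in `P`, and the new parameter and
the size of the new instance are at most `f k` and `g k`, where `k` is the old parameter. -/
structure IsKernelization {ι Γ : Type} (encode : ι × ℕ → List Γ) (size : ι → ℕ)
    (P : Set (ι × ℕ)) (R : ι × ℕ → ι × ℕ) (f g : ℕ → ℕ) : Prop where
  polyTime : Nonempty (Turing.TM2ComputableInPolyTime encode encode R)
  mem_iff : ∀ p : ι × ℕ, p ∈ P ↔ R p ∈ P
  param_le : ∀ p : ι × ℕ, (R p).2 ≤ f p.2
  size_le : ∀ p : ι × ℕ, size (R p).1 ≤ g p.2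

/-! ### Fourth moments of low-degree functions on three-valued coordinates. -/

section Hypercontractivity

open Finset
open scoped BigOperators

/-! If all three choices of a middle variable occur on one set of three variables, every ordering
satisfies exactly one of these three constraints. Deleting them lowers `m / 3` and every count by 1,
so membership is unchanged (`insertCancel_count`). After exhaustive cancellation each triple that
occurs has a variable `s` that is never in the middle (`irreducible_cancel`). It remains to see that
such a list with at least a constant times `κ ^ 2` constraints is always a yes-instance; otherwise
only `O(κ ^ 2)` constraints, and hence occurring variables, are left.

For this (`exists_ordering_above_average`), throw the variables independently into three ordered
buckets and break ties by a random permutation. Given the buckets `φ`, let `X φ` be the expected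
excess over `m / 3`. It has mean zero and is a sum of functions of three coordinates each, and if no
ordering reaches `m / 3 + κ`, then `X ≤ κ` everywhere. Mean zero then gives `E|X| ≤ 2κ`, and the
hypercontractive bound `E X⁴ ≤ 16³ (E X²)²` (`LowDeg.fourth_moment`) turns this into `E X² ≤ 2¹⁷ κ²`
(`LowDeg.expect_sq_le`).

Conversely `E X² ≥ (4 / 6561) m` (`card_le_expect_sq`). Test `X` against a sum of products of
mean-zero weights, one product per constraint, determined by its triple. Different triples are
orthogonal, and on one triple all constraints present correlate with the product with the same value
`-4/81`, precisely because `s` is never in the middle. Nothing cancels, and the two bounds give `m =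
O(κ²)`.

For the running time, a small structured language of stack programs is compiled into Turing machines
(`StackProg.Exec.stepsTo`), and `StackProg.kernelProg` is written in it. All arithmetic is in unary.
Since `κ` is given in binary and may be exponentially large, its value is truncated just above the
number with which its square is compared, which does not affect the outcome
(`StackProg.min_mul_min_le_iff`). -/

theorem expect_fin_three (f : Fin 3 → ℝ) : 𝔼 b, f b = (f 0 + f 1 + f 2) / 3 := by
  rw [Fintype.expect_eq_sum_div_card, Fin.sum_univ_three]
  simp

/-- `f` is a sum of functions of at most `d` of the coordinates each, decomposed coordinate by
coordinate into an average `h` and a mean-zero part `g`. -/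
def LowDeg : (n d : ℕ) → ((Fin n → Fin 3) → ℝ) → Prop
  | 0, _, _ => True
  | n + 1, d, f => ∃ (h : (Fin n → Fin 3) → ℝ) (g : Fin 3 → (Fin n → Fin 3) → ℝ),
      LowDeg n d h ∧ (∀ b, LowDeg n (d - 1) (g b)) ∧ (d = 0 → g = 0) ∧
      (∀ φ, g 0 φ + g 1 φ + g 2 φ = 0) ∧
      ∀ b φ, f (Fin.cons b φ : Fin (n + 1) → Fin 3) = h φ + g b φ

theorem LowDeg.zero (n d : ℕ) : LowDeg n d 0 := by
  induction n generalizing d with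
  | zero => trivial
  | succ n ih => exact ⟨0, 0, ih d, fun _ => ih _, fun _ => rfl, by simp, by simp⟩

theorem LowDeg.add {n d : ℕ} {f f' : (Fin n → Fin 3) → ℝ} (hf : LowDeg n d f)
    (hf' : LowDeg n d f') : LowDeg n d (f + f') := by
  induction n generalizing d with
  | zero => trivial
  | succ n ih =>
    obtain ⟨h, g, h1, h2, h3, h4, h5⟩ := hf
    obtain ⟨h', g', h1', h2', h3', h4', h5'⟩ := hf'
    refine ⟨h + h', g + g', ih h1 h1', fun b => ih (h2 b) (h2' b), fun hd => ?_, fun φ => ?_,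
      fun b φ => ?_⟩
    · rw [h3 hd, h3' hd, add_zero]
    · have := h4 φ
      have := h4' φ
      simp only [Pi.add_apply]
      linarith
    · simp only [Pi.add_apply, h5, h5']
      ring

theorem LowDeg.sum {n d : ℕ} {ι : Type*} (s : Finset ι) (f : ι → (Fin n → Fin 3) → ℝ)
    (hf : ∀ i, LowDeg n d (f i)) : LowDeg n d (fun φ => ∑ i ∈ s, f i φ) := by
  classical
  induction s using Finset.induction_on with
  | empty => exact LowDeg.zero n d
  | insert a s ha ih =>
    simp only [sum_insert ha]
    exact (hf a).add ih

/-- Split off the average over the first coordinate. If that coordinate lies in `A`, the deviation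
from the average depends on one coordinate fewer; if not, the deviation vanishes. -/
theorem LowDeg.of_dependsOn {n d : ℕ} (f : (Fin n → Fin 3) → ℝ) (A : Finset (Fin n))
    (hA : #A ≤ d) (hf : ∀ φ ψ, (∀ i ∈ A, φ i = ψ i) → f φ = f ψ) : LowDeg n d f := by
  induction n generalizing d with
  | zero => trivial
  | succ n ih =>
    set A' : Finset (Fin n) := univ.filter fun i => i.succ ∈ A with hA'
    have hmem : ∀ i, i ∈ A' ↔ i.succ ∈ A := fun i => by simp [hA']
    have hmap : A'.map (Fin.succEmb n) ⊆ A.erase 0 := by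
      intro i hi
      obtain ⟨j, hj, rfl⟩ := mem_map.1 hi
      simpa using (hmem j).1 hj
    have hcard : #A' ≤ #(A.erase 0) := by simpa using card_le_card hmap
    have hcons : ∀ b (φ ψ : Fin n → Fin 3), (∀ i ∈ A', φ i = ψ i) →
        f (Fin.cons b φ : Fin (n + 1) → Fin 3) = f (Fin.cons b ψ : Fin (n + 1) → Fin 3) := by
      intro b φ ψ h
      refine hf _ _ fun i => ?_
      refine Fin.cases (by simp) (fun j hj => ?_) i
      simpa using h j ((hmem j).2 hj)
    set h : (Fin n → Fin 3) → ℝ := fun φ =>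
      (f (Fin.cons 0 φ : Fin (n + 1) → Fin 3) + f (Fin.cons 1 φ : Fin (n + 1) → Fin 3) +
        f (Fin.cons 2 φ : Fin (n + 1) → Fin 3)) / 3 with hh
    have hh' : ∀ φ ψ, (∀ i ∈ A', φ i = ψ i) → h φ = h ψ := by
      intro φ ψ hφ
      simp only [hh, hcons _ φ ψ hφ]
    refine ⟨h, fun b φ => f (Fin.cons b φ : Fin (n + 1) → Fin 3) - h φ,
      ih h A' (hcard.trans ((card_erase_le).trans hA)) hh', fun b => ?_, fun hd => ?_,
      fun φ => ?_, fun b φ => by ring⟩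
    · by_cases h0 : (0 : Fin (n + 1)) ∈ A
      · refine ih _ A' ?_ fun φ ψ hφ => by simp only [hcons _ φ ψ hφ, hh' φ ψ hφ]
        rw [card_erase_of_mem h0] at hcard
        omega
      · have hb : ∀ (b : Fin 3) (φ : Fin n → Fin 3), f (Fin.cons b φ : Fin (n + 1) → Fin 3) =
            f (Fin.cons 0 φ : Fin (n + 1) → Fin 3) := by
          intro b φ
          refine hf _ _ fun i => ?_
          refine Fin.cases (fun h => absurd h h0) (fun j _ => by simp) i
        have heq : (fun φ => f (Fin.cons b φ : Fin (n + 1) → Fin 3) - h φ) = 0 := by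
          funext φ
          simp only [hh, hb b φ, hb 1 φ, hb 2 φ, Pi.zero_apply]
          ring
        have hz := LowDeg.zero n (d - 1)
        rwa [← heq] at hz
    · have hA0 : A = ∅ := by
        rw [← card_eq_zero]
        omega
      funext b φ
      have hb : ∀ (b : Fin 3), f (Fin.cons b φ : Fin (n + 1) → Fin 3) =
          f (Fin.cons 0 φ : Fin (n + 1) → Fin 3) := fun b => hf _ _ (by simp [hA0])
      simp only [hh, hb b, hb 1, hb 2, Pi.zero_apply]
      ring
    · simp only [hh]
      ring

theorem expect_cons {n : ℕ} (f : (Fin (n + 1) → Fin 3) → ℝ) :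
    𝔼 φ, f φ = 𝔼 φ : Fin n → Fin 3, (f (Fin.cons 0 φ : Fin (n + 1) → Fin 3) +
      f (Fin.cons 1 φ : Fin (n + 1) → Fin 3) + f (Fin.cons 2 φ : Fin (n + 1) → Fin 3)) / 3 := by
  have h : 𝔼 p : Fin 3 × (Fin n → Fin 3), f (Fin.cons p.1 p.2 : Fin (n + 1) → Fin 3) = 𝔼 φ, f φ :=
    Fintype.expect_equiv (Fin.consEquiv fun _ => Fin 3) _ _ fun p => rfl
  rw [← h, ← univ_product_univ, expect_product, expect_comm]
  refine expect_congr rfl fun φ _ => ?_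
  exact expect_fin_three fun b => f (Fin.cons b φ : Fin (n + 1) → Fin 3)

theorem expect_mul_sq_le {α : Type*} [Fintype α] [Nonempty α] (f g : α → ℝ) :
    (𝔼 i, f i * g i) ^ 2 ≤ (𝔼 i, f i ^ 2) * 𝔼 i, g i ^ 2 := by
  simp only [Fintype.expect_eq_sum_div_card]
  rw [div_pow, div_mul_div_comm, ← pow_two]
  gcongr
  exact sum_mul_sq_le_sq_mul_sq _ _ _

/-- In the binomial expansion the terms linear in `a`, `b`, `c` cancel, and the cubic ones are
absorbed by `2 h a³ ≤ h² a² + a⁴`, that is `a² (h - a)² ≥ 0`. -/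
theorem fourth_moment_step (a b c h : ℝ) (h0 : a + b + c = 0) :
    ((h + a) ^ 4 + (h + b) ^ 4 + (h + c) ^ 4) / 3 ≤
      h ^ 4 + 8 / 3 * (h ^ 2 * a ^ 2 + h ^ 2 * b ^ 2 + h ^ 2 * c ^ 2) +
        (a ^ 4 + b ^ 4 + c ^ 4) := by
  obtain rfl : c = -a - b := by linarith
  nlinarith [mul_nonneg (sq_nonneg a) (sq_nonneg (h - a)),
    mul_nonneg (sq_nonneg b) (sq_nonneg (h - b)),
    mul_nonneg (sq_nonneg (-a - b)) (sq_nonneg (h - (-a - b)))]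

/-- The fourth moment of a function of low degree is controlled by its second moment. -/
theorem LowDeg.fourth_moment {n d : ℕ} {f : (Fin n → Fin 3) → ℝ} (hf : LowDeg n d f) :
    𝔼 φ, f φ ^ 4 ≤ 16 ^ d * (𝔼 φ, f φ ^ 2) ^ 2 := by
  induction n generalizing d with
  | zero =>
    have h1 : (1 : ℝ) ≤ 16 ^ d := one_le_pow₀ (by norm_num)
    have h2 : ∀ F : (Fin 0 → Fin 3) → ℝ, 𝔼 φ, F φ = F default := fun F => by
      rw [Fintype.expect_eq_sum_div_card, Fintype.sum_unique, Fintype.card_unique]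
      simp only [Nat.cast_one, div_one]
      exact congrArg F (Subsingleton.elim _ _)
    rw [h2, h2]
    nlinarith [sq_nonneg (f default ^ 2)]
  | succ n ih =>
    obtain ⟨h, g, hh, hg, hg0, hsum, hfe⟩ := hf
    have hne : Nonempty (Fin n → Fin 3) := inferInstance
    have key2 : 𝔼 φ, f φ ^ 2 = 𝔼 φ, h φ ^ 2 +
        (𝔼 φ, g 0 φ ^ 2 + 𝔼 φ, g 1 φ ^ 2 + 𝔼 φ, g 2 φ ^ 2) / 3 := by
      rw [expect_cons, ← expect_add_distrib, ← expect_add_distrib, expect_div,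
        ← expect_add_distrib]
      refine expect_congr rfl fun φ _ => ?_
      simp only [hfe]
      linear_combination (2 / 3 * h φ) * hsum φ
    have key4 : 𝔼 φ, f φ ^ 4 ≤ 𝔼 φ, h φ ^ 4 + 8 / 3 * (𝔼 φ, h φ ^ 2 * g 0 φ ^ 2 +
        𝔼 φ, h φ ^ 2 * g 1 φ ^ 2 + 𝔼 φ, h φ ^ 2 * g 2 φ ^ 2) +
        (𝔼 φ, g 0 φ ^ 4 + 𝔼 φ, g 1 φ ^ 4 + 𝔼 φ, g 2 φ ^ 4) := by
      rw [expect_cons]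
      simp only [← expect_add_distrib, mul_expect]
      refine expect_le_expect fun φ _ => ?_
      simp only [hfe]
      exact fourth_moment_step _ _ _ _ (hsum φ)
    rcases d with _ | e
    · rw [key2]
      refine key4.trans ?_
      have := ih hh
      simp [hg0 rfl] at this ⊢
      exact this
    · have hH := ih hh
      -- Cauchy–Schwarz and the two inductive bounds; as `g b` has smaller degree, the constant is
      -- the root of `16 ^ (e + 1) * 16 ^ e`.
      have hcs : ∀ b, 𝔼 φ, h φ ^ 2 * g b φ ^ 2 ≤
          4 * 16 ^ e * ((𝔼 φ, h φ ^ 2) * 𝔼 φ, g b φ ^ 2) := by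
        intro b
        have hG := ih (hg b)
        have hp : ∀ F : (Fin n → Fin 3) → ℝ, 0 ≤ 𝔼 φ, F φ ^ 2 :=
          fun F => expect_nonneg fun φ _ => sq_nonneg _
        refine abs_le_of_sq_le_sq' ?_ (by have := hp h; have := hp (g b); positivity) |>.2
        refine (expect_mul_sq_le _ _).trans ?_
        simp only [← pow_mul]
        have : 0 ≤ 𝔼 φ, g b φ ^ 4 := expect_nonneg fun φ _ => by positivity
        calc _ ≤ (16 ^ (e + 1) * (𝔼 φ, h φ ^ 2) ^ 2) * (16 ^ e * (𝔼 φ, g b φ ^ 2) ^ 2) :=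
              mul_le_mul hH hG this (by positivity)
          _ = _ := by ring
      have h0 := hcs 0
      have h1 := hcs 1
      have h2 := hcs 2
      have g0 := ih (hg 0)
      have g1 := ih (hg 1)
      have g2 := ih (hg 2)
      have hp : ∀ F : (Fin n → Fin 3) → ℝ, 0 ≤ 𝔼 φ, F φ ^ 2 :=
        fun F => expect_nonneg fun φ _ => sq_nonneg _
      have p0 := hp (g 0)
      have p1 := hp (g 1)
      have p2 := hp (g 2)
      rw [key2]
      simp only [Nat.add_sub_cancel] at g0 g1 g2
      generalize 𝔼 φ, h φ ^ 2 = H at *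
      generalize 𝔼 φ, g 0 φ ^ 2 = G0 at *
      generalize 𝔼 φ, g 1 φ ^ 2 = G1 at *
      generalize 𝔼 φ, g 2 φ ^ 2 = G2 at *
      have hK : (0 : ℝ) ≤ 16 ^ e := by positivity
      refine key4.trans ?_
      rw [pow_succ] at hH ⊢
      -- The base 16 is chosen so that the terms mixed in `H` and the `G`s agree: `8/3 * 4 = 16 *
      -- 2/3`. What remains is `G0² + G1² + G2² ≤ 16/9 * (G0 + G1 + G2)²`.
      have hA : (0 : ℝ) ≤ 16 ^ e * (G0 * G1 + G0 * G2 + G1 * G2) := by positivity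
      have hB : (0 : ℝ) ≤ 16 ^ e * (G0 ^ 2 + G1 ^ 2 + G2 ^ 2) := by positivity
      linarith

end Hypercontractivity

/-! ### Random orderings from three buckets. -/

section RandomOrderings

open Finset Equiv
open scoped BigOperators

/-- Any injective labelling by natural numbers is order isomorphic to an ordering. -/
theorem exists_ordering_of_injective {n : ℕ} (f : Fin n → ℕ) (hf : Function.Injective f) :
    ∃ α : Fin n ≃ Fin n, ∀ u v, α u < α v ↔ f u < f v := by
  have hmono : StrictMono (f ∘ Tuple.sort f) :=
    (Tuple.monotone_sort f).strictMono_of_injective (hf.comp (Tuple.sort f).injective)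
  refine ⟨(Tuple.sort f).symm, fun u v => ?_⟩
  rw [← hmono.lt_iff_lt]
  simp

/-- The place of a variable: first its bucket, then its position in `π`. -/
def bucketKey {n : ℕ} (φ : Fin n → Fin 3) (π : Perm (Fin n)) (u : Fin n) : ℕ :=
  φ u * n + π u

theorem bucketKey_lt {n : ℕ} (φ : Fin n → Fin 3) (π : Perm (Fin n)) (u v : Fin n) :
    bucketKey φ π u < bucketKey φ π v ↔ φ u < φ v ∨ φ u = φ v ∧ π u < π v := by
  unfold bucketKey
  have hu := (π u).isLt
  have hv := (π v).isLt
  rcases lt_trichotomy (φ u) (φ v) with h | h | h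
  · have h' : ((φ u : ℕ) + 1) * n ≤ φ v * n := Nat.mul_le_mul_right _ h
    simp only [h, true_or, iff_true]
    nlinarith
  · simp [h]
  · have h' : ((φ v : ℕ) + 1) * n ≤ φ u * n := Nat.mul_le_mul_right _ h
    simp only [h.not_gt, h.ne', false_and, or_self, iff_false, not_lt]
    nlinarith

theorem bucketKey_injective {n : ℕ} (φ : Fin n → Fin 3) (π : Perm (Fin n)) :
    Function.Injective (bucketKey φ π) := by
  intro u v h
  have h1 := (bucketKey_lt φ π u v).not.1 (by omega)
  have h2 := (bucketKey_lt φ π v u).not.1 (by omega)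
  push Not at h1 h2
  have h3 : φ u = φ v := le_antisymm h2.1 h1.1
  exact π.injective (le_antisymm (h2.2 h3.symm) (h1.2 h3))

/-- The ordering given by the buckets `φ`, with ties broken by `π`. -/
noncomputable def bucketOrdering {n : ℕ} (φ : Fin n → Fin 3) (π : Perm (Fin n)) : Fin n ≃ Fin n :=
  (exists_ordering_of_injective _ (bucketKey_injective φ π)).choose

theorem bucketOrdering_lt {n : ℕ} (φ : Fin n → Fin 3) (π : Perm (Fin n)) (u v : Fin n) :
    bucketOrdering φ π u < bucketOrdering φ π v ↔ φ u < φ v ∨ φ u = φ v ∧ π u < π v := by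
  rw [← bucketKey_lt]
  exact (exists_ordering_of_injective _ (bucketKey_injective φ π)).choose_spec u v

/-- The indicator of a proposition. -/
noncomputable def indic (p : Prop) [Decidable p] : ℝ :=
  if p then 1 else 0

theorem indic_true : indic True = 1 := by simp [indic]

theorem indic_false : indic False = 0 := by simp [indic]

/-- Composition with the transposition of `u` and `v` exchanges the two possible orders. -/
theorem expect_perm_lt {n : ℕ} {u v : Fin n} (h : u ≠ v) :
    𝔼 π : Perm (Fin n), indic (π u < π v) = 1 / 2 := by
  have h1 : 𝔼 π : Perm (Fin n), indic (π u < π v) = 𝔼 π : Perm (Fin n), indic (π v < π u) :=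
    Fintype.expect_equiv (Equiv.mulRight (swap u v)) _ _ fun π => by simp
  have h2 : 𝔼 π : Perm (Fin n), indic (π u < π v) + 𝔼 π : Perm (Fin n), indic (π v < π u) = 1 := by
    rw [← expect_add_distrib, ← Fintype.expect_const (ι := Perm (Fin n)) (1 : ℝ)]
    refine expect_congr rfl fun π _ => ?_
    unfold indic
    rcases lt_or_gt_of_ne (π.injective.ne h) with h' | h'
    · simp [h', h'.not_gt]
    · simp [h', h'.not_gt]
  linarith

/-- By symmetry under transpositions each of the three variables is equally likely to be in the
middle, and exactly one of them is. -/
theorem expect_perm_between {n : ℕ} {u v w : Fin n} (huv : u ≠ v) (huw : u ≠ w) (hvw : v ≠ w) :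
    𝔼 π : Perm (Fin n), indic ((π v < π u ∧ π u < π w) ∨ (π w < π u ∧ π u < π v)) = 1 / 3 := by
  set B : Fin n → Fin n → Fin n → ℝ := fun u v w =>
    𝔼 π : Perm (Fin n), indic ((π v < π u ∧ π u < π w) ∨ (π w < π u ∧ π u < π v)) with hB
  have h1 : B u v w = B v u w :=
    Fintype.expect_equiv (Equiv.mulRight (swap u v)) _ _ fun π => by
      simp [swap_apply_of_ne_of_ne huw.symm hvw.symm]
  have h2 : B u v w = B w v u :=
    Fintype.expect_equiv (Equiv.mulRight (swap u w)) _ _ fun π => by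
      simp [swap_apply_of_ne_of_ne huv.symm hvw]
  have h3 : B u v w + B v u w + B w v u = 1 := by
    simp only [hB]
    rw [← expect_add_distrib, ← expect_add_distrib,
      ← Fintype.expect_const (ι := Perm (Fin n)) (1 : ℝ)]
    refine expect_congr rfl fun π _ => ?_
    have e1 := π.injective.ne huv
    have e2 := π.injective.ne huw
    have e3 := π.injective.ne hvw
    generalize π u = a at *
    generalize π v = b at *
    generalize π w = c at *
    unfold indic
    rcases lt_or_gt_of_ne e1 with h | h <;> rcases lt_or_gt_of_ne e2 with h' | h' <;>
      rcases lt_or_gt_of_ne e3 with h'' | h'' <;>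
      first
        | (exfalso; omega)
        | simp [h, h', h'', h.not_gt, h'.not_gt, h''.not_gt]
  change B u v w = 1 / 3
  linarith

/-- The probability that a constraint is satisfied when its variables lie in the buckets `i` (the
middle one), `j` and `k` and ties are broken at random. -/
noncomputable def bucketProb (i j k : Fin 3) : ℝ :=
  if i = j ∧ i = k then 1 / 3
  else if j = k then 0
  else if i = j ∨ i = k then 1 / 2
  else if (j < i ∧ i < k) ∨ (k < i ∧ i < j) then 1
  else 0

namespace BetweennessConstraint

variable {n : ℕ}

/-- The advantage over `1 / 3` of the buckets `φ` on the constraint `c`. -/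
noncomputable def gain (c : BetweennessConstraint n) (φ : Fin n → Fin 3) : ℝ :=
  bucketProb (φ c.mid) (φ c.left) (φ c.right) - 1 / 3

/-- Once the relative order of the three buckets is fixed, only comparisons within a bucket still
depend on `π`; they contribute probability 1/2 for one tie and 1/3 for a triple tie. -/
theorem expect_satisfiedBy (c : BetweennessConstraint n) (φ : Fin n → Fin 3) :
    𝔼 π : Perm (Fin n), indic (c.SatisfiedBy (bucketOrdering φ π)) = c.gain φ + 1 / 3 := by
  obtain ⟨u, v, w, huv, huw, hvw⟩ := c
  simp only [SatisfiedBy, bucketOrdering_lt, gain, bucketProb, sub_add_cancel]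
  have h1 := expect_perm_lt huv
  have h2 := expect_perm_lt huv.symm
  have h3 := expect_perm_lt huw
  have h4 := expect_perm_lt huw.symm
  have h5 := expect_perm_between huv huw hvw
  have hne : Nonempty (Perm (Fin n)) := inferInstance
  generalize φ u = a
  generalize φ v = b
  generalize φ w = c
  rcases lt_trichotomy a b with h | h | h <;>
  rcases lt_trichotomy a c with h' | h' | h' <;>
  rcases lt_trichotomy b c with h'' | h'' | h'' <;>
  first
    | (exfalso; omega)
    | (subst_vars
       simp_all [not_lt_of_gt, ne_of_lt, ne_of_gt, indic_true, indic_false])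

end BetweennessConstraint

end RandomOrderings

/-! ### Lower bound for the second moment. -/

section SecondMoment

open Finset Equiv
open scoped BigOperators

/-- Exchanging the value at `u` with a fresh independent value is an involution of the product
space. -/
theorem expect_update {n : ℕ} (F : (Fin n → Fin 3) → ℝ) (u : Fin n) :
    𝔼 φ, F φ = 𝔼 φ, 𝔼 b, F (Function.update φ u b) := by
  let e : (Fin n → Fin 3) × Fin 3 ≃ (Fin n → Fin 3) × Fin 3 :=
    { toFun := fun p => (Function.update p.1 u p.2, p.1 u)
      invFun := fun p => (Function.update p.1 u p.2, p.1 u)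
      left_inv := fun p => by simp
      right_inv := fun p => by simp }
  have h : 𝔼 p : (Fin n → Fin 3) × Fin 3, F (Function.update p.1 u p.2) =
      𝔼 p : (Fin n → Fin 3) × Fin 3, F p.1 := Fintype.expect_equiv e _ _ fun p => rfl
  rw [← univ_product_univ, expect_product, expect_product] at h
  rw [h]
  simp

theorem expect_three {n : ℕ} (F : Fin 3 → Fin 3 → Fin 3 → ℝ) {u v w : Fin n} (huv : u ≠ v)
    (huw : u ≠ w) (hvw : v ≠ w) :
    𝔼 φ : Fin n → Fin 3, F (φ u) (φ v) (φ w) = 𝔼 a, 𝔼 b, 𝔼 c, F a b c := by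
  rw [expect_update _ u]
  have h1 : ∀ a, 𝔼 φ : Fin n → Fin 3, F a (φ v) (φ w) = 𝔼 b, 𝔼 c, F a b c := by
    intro a
    rw [expect_update _ v]
    have h2 : ∀ b, 𝔼 φ : Fin n → Fin 3, F a b (φ w) = 𝔼 c, F a b c := by
      intro b
      rw [expect_update _ w]
      simp
    rw [expect_comm]
    simp [hvw.symm, h2]
  rw [expect_comm]
  simp [huv.symm, huw.symm, h1]

/-- A mean-zero function on the buckets, invariant under reversing their order. -/
def evenWeight : Fin 3 → ℝ := ![1, -2, 1]

/-- A mean-zero function on the buckets that changes sign when their order is reversed. -/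
def oddWeight : Fin 3 → ℝ := ![-1, 0, 1]

theorem evenWeight_zero : evenWeight 0 = 1 := rfl

theorem evenWeight_one : evenWeight 1 = -2 := rfl

theorem evenWeight_two : evenWeight 2 = 1 := rfl

theorem oddWeight_zero : oddWeight 0 = -1 := rfl

theorem oddWeight_one : oddWeight 1 = 0 := rfl

theorem oddWeight_two : oddWeight 2 = 1 := rfl

/-- The product over `T` of the even weight at `s` and the odd weights elsewhere. -/
def weightProd {n : ℕ} (s : Fin n) (T : Finset (Fin n)) (φ : Fin n → Fin 3) : ℝ :=
  ∏ w ∈ T, if w = s then evenWeight (φ w) else oddWeight (φ w)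

/-- Integrate out `w` first: `F` is constant in it, and both weights have mean zero. -/
theorem expect_mul_weightProd_eq_zero {n : ℕ} (s : Fin n) {T : Finset (Fin n)} {w : Fin n}
    (hw : w ∈ T) (F : (Fin n → Fin 3) → ℝ) (hF : ∀ φ b, F (Function.update φ w b) = F φ) :
    𝔼 φ, F φ * weightProd s T φ = 0 := by
  rw [expect_update _ w]
  refine (expect_congr rfl fun φ _ => ?_).trans (expect_const_zero univ)
  have h : ∀ b, weightProd s T (Function.update φ w b) =
      (if w = s then evenWeight b else oddWeight b) * weightProd s (T.erase w) φ := by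
    intro b
    unfold weightProd
    rw [← mul_prod_erase _ _ hw]
    congr 1
    · simp
    · refine prod_congr rfl fun i hi => ?_
      rw [Function.update_of_ne (ne_of_mem_erase hi)]
  simp only [h, hF]
  rw [expect_fin_three]
  split_ifs
  · simp [evenWeight]
    ring
  · simp [oddWeight]

theorem sq_weightProd_le {n : ℕ} (s : Fin n) {T : Finset (Fin n)} (hs : s ∈ T)
    (φ : Fin n → Fin 3) : weightProd s T φ ^ 2 ≤ 4 := by
  have he : ∀ b, evenWeight b ^ 2 ≤ 4 := by
    intro b
    fin_cases b <;> norm_num [evenWeight]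
  have ho : ∀ b, oddWeight b ^ 2 ≤ 1 := by
    intro b
    fin_cases b <;> norm_num [oddWeight]
  unfold weightProd
  rw [← mul_prod_erase _ _ hs, mul_pow, ← prod_pow]
  have h1 : ∏ w ∈ T.erase s, (if w = s then evenWeight (φ w) else oddWeight (φ w)) ^ 2 ≤ 1 := by
    refine prod_le_one (fun i _ => sq_nonneg _) fun i hi => ?_
    rw [if_neg (ne_of_mem_erase hi)]
    exact ho _
  have h2 := he (φ s)
  simp only [if_true]
  nlinarith [sq_nonneg (evenWeight (φ s))]

namespace BetweennessConstraint

variable {n : ℕ}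

/-- The set of the three variables of a constraint. -/
def vars (c : BetweennessConstraint n) : Finset (Fin n) :=
  {c.mid, c.left, c.right}

theorem card_vars (c : BetweennessConstraint n) : #c.vars = 3 :=
  card_eq_three.2 ⟨_, _, _, c.mid_ne_left, c.mid_ne_right, c.left_ne_right, rfl⟩

theorem exists_mem_vars_notMem (c d : BetweennessConstraint n) (h : c.vars ≠ d.vars) :
    ∃ w ∈ d.vars, w ∉ c.vars := by
  by_contra! hcon
  exact h (eq_of_subset_of_card_le hcon (by rw [card_vars, card_vars])).symm

theorem gain_congr (c : BetweennessConstraint n) {φ ψ : Fin n → Fin 3}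
    (h : ∀ i ∈ c.vars, φ i = ψ i) : c.gain φ = c.gain ψ := by
  unfold gain
  rw [h c.mid (by simp [vars]), h c.left (by simp [vars]), h c.right (by simp [vars])]

theorem lowDeg_gain (c : BetweennessConstraint n) : LowDeg n 3 c.gain :=
  LowDeg.of_dependsOn _ c.vars c.card_vars.le fun _ _ h => c.gain_congr h

theorem expect_gain (c : BetweennessConstraint n) : 𝔼 φ, c.gain φ = 0 := by
  have h := expect_three (fun i j k => bucketProb i j k - 1 / 3) c.mid_ne_left c.mid_ne_right
    c.left_ne_right
  unfold gain
  rw [h]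
  simp only [expect_fin_three, bucketProb]
  norm_num [Fin.ext_iff, Fin.lt_def]

theorem expect_gain_mul_weightProd_of_ne (c : BetweennessConstraint n) (s : Fin n)
    (d : BetweennessConstraint n) (h : c.vars ≠ d.vars) :
    𝔼 φ, c.gain φ * weightProd s d.vars φ = 0 := by
  obtain ⟨w, hw, hw'⟩ := c.exists_mem_vars_notMem d h
  refine expect_mul_weightProd_eq_zero s hw _ fun φ b => c.gain_congr fun i hi => ?_
  rw [Function.update_of_ne (by rintro rfl; exact hw' hi)]

/-- A finite computation over 27 placements. The three gains on one triple sum to zero, so the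
constraint with `s` in the middle would give `8/81` instead; excluding it by `hm` is what prevents
cancellation. -/
theorem expect_gain_mul_weightProd (c : BetweennessConstraint n) {s : Fin n} (hs : s ∈ c.vars)
    (hm : s ≠ c.mid) : 𝔼 φ, c.gain φ * weightProd s c.vars φ = -(4 / 81) := by
  obtain ⟨u, v, w, huv, huw, hvw⟩ := c
  have hprod : ∀ φ, weightProd s ({u, v, w} : Finset (Fin n)) φ =
      (if u = s then evenWeight (φ u) else oddWeight (φ u)) *
      ((if v = s then evenWeight (φ v) else oddWeight (φ v)) *
      (if w = s then evenWeight (φ w) else oddWeight (φ w))) := by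
    intro φ
    unfold weightProd
    rw [prod_insert (by simp [huv, huw]), prod_insert (by simp [hvw]), prod_singleton]
  simp only [vars, mem_insert, mem_singleton] at hs hm
  simp only [gain, vars, hprod]
  have hn := expect_three (fun i j k => (bucketProb i j k - 1 / 3) *
      ((if u = s then evenWeight i else oddWeight i) *
      ((if v = s then evenWeight j else oddWeight j) *
      (if w = s then evenWeight k else oddWeight k)))) huv huw hvw
  rw [hn]
  have hus : u ≠ s := hm.symm
  rcases hs with rfl | rfl | rfl
  · exact absurd rfl hm
  · simp only [if_neg hus, if_neg hvw.symm, if_true, expect_fin_three, bucketProb]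
    simp only [evenWeight_zero, evenWeight_one, evenWeight_two, oddWeight_zero, oddWeight_one,
      oddWeight_two]
    norm_num [Fin.ext_iff, Fin.lt_def]
  · simp only [if_neg hus, if_neg hvw, if_true, expect_fin_three, bucketProb]
    simp only [evenWeight_zero, evenWeight_one, evenWeight_two, oddWeight_zero, oddWeight_one,
      oddWeight_two]
    norm_num [Fin.ext_iff, Fin.lt_def]

/-- Let `P` count the ordered pairs of constraints on equal triples; it is at least the number of
constraints, by the diagonal. Against the sum of the `χ j`, the total gain has inner product
`-(4/81) P`, while that sum has second moment at most `4 P`. Cauchy–Schwarz gives `(4/81)² P² ≤ E X²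
* 4 P`. -/
theorem card_le_expect_sq {ι : Type*} [Fintype ι] (c : ι → BetweennessConstraint n)
    (sp : Finset (Fin n) → Fin n) (hsp : ∀ i, sp (c i).vars ∈ (c i).vars)
    (hmid : ∀ i, sp (c i).vars ≠ (c i).mid) :
    4 / 6561 * (Fintype.card ι : ℝ) ≤ 𝔼 φ, (∑ i, (c i).gain φ) ^ 2 := by
  classical
  set χ : ι → (Fin n → Fin 3) → ℝ := fun i => weightProd (sp (c i).vars) (c i).vars with hχ
  set P : ℝ := ∑ i, ∑ j, if (c i).vars = (c j).vars then 1 else 0 with hP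
  have hne : Nonempty (Fin n → Fin 3) := ⟨fun _ => 0⟩
  have hP1 : (Fintype.card ι : ℝ) ≤ P := by
    rw [hP, ← card_univ, card_eq_sum_ones, Nat.cast_sum]
    refine sum_le_sum fun i _ => ?_
    rw [← Finset.add_sum_erase _ _ (mem_univ i)]
    simp only [Nat.cast_one, if_true]
    have : 0 ≤ ∑ x ∈ univ.erase i, if (c i).vars = (c x).vars then (1 : ℝ) else 0 :=
      sum_nonneg fun j _ => by split_ifs <;> norm_num
    linarith
  have h1 : 𝔼 φ, (∑ i, (c i).gain φ) * (∑ j, χ j φ) = -(4 / 81) * P := by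
    simp only [sum_mul_sum]
    rw [expect_sum_comm, hP, mul_sum]
    refine sum_congr rfl fun i _ => ?_
    rw [expect_sum_comm, mul_sum]
    refine sum_congr rfl fun j _ => ?_
    split_ifs with h
    · simp only [hχ, ← h, mul_one]
      exact (c i).expect_gain_mul_weightProd (hsp i) (hmid i)
    · simp only [hχ, mul_zero]
      exact (c i).expect_gain_mul_weightProd_of_ne _ _ h
  have h2 : 𝔼 φ, (∑ j, χ j φ) ^ 2 ≤ 4 * P := by
    simp only [sq, sum_mul_sum]
    rw [expect_sum_comm, hP, mul_sum]
    refine sum_le_sum fun i _ => ?_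
    rw [expect_sum_comm, mul_sum]
    refine sum_le_sum fun j _ => ?_
    split_ifs with h
    · simp only [hχ, ← h, mul_one, ← sq]
      refine (expect_le_expect fun φ _ => sq_weightProd_le _ (hsp i) φ).trans ?_
      rw [Fintype.expect_const]
    · simp only [hχ, mul_zero]
      obtain ⟨w, hw, hw'⟩ := (c i).exists_mem_vars_notMem (c j) h
      refine (expect_mul_weightProd_eq_zero _ hw _ fun φ b => ?_).le
      refine prod_congr rfl fun k hk => ?_
      rw [Function.update_of_ne (by rintro rfl; exact hw' hk)]
  have h3 := expect_mul_sq_le (fun φ => ∑ i, (c i).gain φ) (fun φ => ∑ j, χ j φ)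
  rw [h1] at h3
  have h4 : 0 ≤ 𝔼 φ, (∑ i, (c i).gain φ) ^ 2 := expect_nonneg fun φ _ => sq_nonneg _
  rcases eq_or_lt_of_le ((Nat.cast_nonneg _).trans hP1) with h0 | h0
  · have : (Fintype.card ι : ℝ) = 0 := le_antisymm (h0 ▸ hP1) (Nat.cast_nonneg _)
    rw [this]
    simpa using h4
  · have h5 := h3.trans (mul_le_mul_of_nonneg_left h2 h4)
    have h6 : 4 / 6561 * P ≤ 𝔼 φ, (∑ i, (c i).gain φ) ^ 2 := by
      have : 4 / 6561 * P * (4 * P) ≤ (𝔼 φ, (∑ i, (c i).gain φ) ^ 2) * (4 * P) := by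
        linarith
      exact le_of_mul_le_mul_right this (by linarith)
    linarith

end BetweennessConstraint

/-! ### Upper bound for the second moment, and orderings above average. -/

/-- A mean-zero function of degree at most three that is bounded above has small variance. -/
theorem LowDeg.expect_sq_le {n : ℕ} {X : (Fin n → Fin 3) → ℝ} (hX : LowDeg n 3 X)
    (h0 : 𝔼 φ, X φ = 0) {κ : ℝ} (hκ : 0 < κ) (hle : ∀ φ, X φ ≤ κ) :
    𝔼 φ, X φ ^ 2 ≤ 131072 * κ ^ 2 := by
  set V := 𝔼 φ, X φ ^ 2 with hV
  have hV0 : 0 ≤ V := expect_nonneg fun φ _ => sq_nonneg _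
  rcases eq_or_lt_of_le hV0 with h | hVpos
  · rw [← h]
    positivity
  have h4 := hX.fourth_moment
  rw [← hV] at h4
  have hne : Nonempty (Fin n → Fin 3) := ⟨fun _ => 0⟩
  -- For either sign of `X φ`, the bound `X φ ≤ κ` gives `|X φ| ≤ 2 κ - X φ`, whose mean is `2 κ`.
  have habs : 𝔼 φ, |X φ| ≤ 2 * κ := by
    have h1 : 𝔼 φ, |X φ| ≤ 𝔼 φ, (2 * κ - X φ) := by
      refine expect_le_expect fun φ _ => ?_
      have := hle φ
      rw [abs_le]
      constructor <;> linarith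
    rw [expect_sub_distrib, h0, Fintype.expect_const, sub_zero] at h1
    exact h1
  -- The truncation level at which small values contribute at most `t * 2κ = V / 2` to the variance,
  -- so that half of `V` must come from the fourth moment.
  set t := V / (4 * κ) with ht
  have htpos : 0 < t := by positivity
  have hpt : ∀ x : ℝ, x ^ 2 ≤ t * |x| + x ^ 4 / t ^ 2 := by
    intro x
    rcases le_total |x| t with h | h
    · have h1 : x ^ 2 ≤ t * |x| := by
        rw [← sq_abs, sq]
        exact mul_le_mul_of_nonneg_right h (abs_nonneg _)
      have : 0 ≤ x ^ 4 / t ^ 2 := by positivity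
      linarith
    · have h1 : x ^ 2 ≤ x ^ 4 / t ^ 2 := by
        rw [le_div_iff₀ (by positivity)]
        have : t ^ 2 ≤ x ^ 2 := by
          rw [← sq_abs x]
          gcongr
        nlinarith [sq_nonneg x]
      have : 0 ≤ t * |x| := by positivity
      linarith
  have h5 : V ≤ t * (2 * κ) + 16 ^ 3 * V ^ 2 / t ^ 2 := by
    calc V ≤ 𝔼 φ, (t * |X φ| + X φ ^ 4 / t ^ 2) := expect_le_expect fun φ _ => hpt _
      _ = t * 𝔼 φ, |X φ| + (𝔼 φ, X φ ^ 4) / t ^ 2 := by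
        rw [expect_add_distrib, ← mul_expect, ← expect_div]
      _ ≤ _ := by gcongr
  have h6 : t * (2 * κ) = V / 2 := by
    rw [ht]
    field_simp
    ring
  have h7 : 16 ^ 3 * V ^ 2 / t ^ 2 = 65536 * κ ^ 2 := by
    rw [ht]
    field_simp
    ring
  linarith

theorem sum_map_ite_eq_countP {α : Type*} (p : α → Prop) [DecidablePred p] (l : List α) :
    (l.map fun a => if p a then (1 : ℝ) else 0).sum = (l.countP fun a => decide (p a) : ℕ) := by
  induction l with
  | nil => simp
  | cons a l ih =>
    rw [List.map_cons, List.sum_cons, ih, List.countP_cons]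
    by_cases h : p a <;> simp [h, add_comm]

/-- Linearity of expectation. Any bound on the excess of all orderings thus passes to the total
gain. -/
theorem sum_gain_eq_expect {n : ℕ} (L : List (BetweennessConstraint n)) (φ : Fin n → Fin 3) :
    ∑ i : Fin L.length, L[i].gain φ = 𝔼 π : Perm (Fin n),
      ((L.countP fun c => decide (c.SatisfiedBy (bucketOrdering φ π)) : ℕ) -
        (L.length : ℝ) / 3) := by
  have h1 : ∀ i : Fin L.length, L[i].gain φ =
      𝔼 π : Perm (Fin n), (indic (L[i].SatisfiedBy (bucketOrdering φ π)) - 1 / 3) := by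
    intro i
    rw [expect_sub_distrib, BetweennessConstraint.expect_satisfiedBy, Fintype.expect_const]
    ring
  simp only [h1]
  rw [← expect_sum_comm]
  refine expect_congr rfl fun π _ => ?_
  have h2 : ∑ i : Fin L.length, indic (L[i].SatisfiedBy (bucketOrdering φ π)) =
      (L.countP fun c => decide (c.SatisfiedBy (bucketOrdering φ π)) : ℕ) :=
    (Fin.sum_univ_fun_getElem L
      (fun c => if c.SatisfiedBy (bucketOrdering φ π) then (1 : ℝ) else 0)).trans
      (sum_map_ite_eq_countP _ _)
  rw [sum_sub_distrib, h2]
  simp only [sum_const, card_univ, Fintype.card_fin, nsmul_eq_mul]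
  ring

/-- Some ordering satisfies at least a third of the constraints. -/
theorem exists_ordering_average {n : ℕ} (L : List (BetweennessConstraint n)) :
    ∃ α : Fin n ≃ Fin n, (L.length : ℚ) / 3 ≤
      (L.countP fun c => decide (c.SatisfiedBy α) : ℕ) := by
  -- With all variables in one bucket every gain is zero, and the ordering is uniformly random.
  have h := sum_gain_eq_expect L fun _ => 0
  have h0 : ∀ c : BetweennessConstraint n, c.gain (fun _ => 0) = 0 := fun c => by
    simp [BetweennessConstraint.gain, bucketProb]
  simp only [h0, sum_const_zero] at h
  obtain ⟨π, -, hπ⟩ := exists_le_of_le_expect univ_nonempty h.le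
  refine ⟨bucketOrdering (fun _ => 0) π, ?_⟩
  have h1 := sub_nonneg.1 hπ
  rw [← Rat.cast_le (K := ℝ)]
  push_cast
  exact h1

open BetweennessConstraint in
/-- If no set of three variables carries all three kinds of constraints and there are many
constraints, then some ordering beats the average by `κ`. -/
theorem exists_ordering_above_average {n : ℕ} (L : List (BetweennessConstraint n))
    (hL : ∀ c ∈ L, ∃ s ∈ c.vars, ∀ d ∈ L, d.vars = c.vars → s ≠ d.mid) {κ : ℕ} (hκ : 0 < κ)
    (hlen : (2 ^ 15 * κ) ^ 2 ≤ 3 * L.length) :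
    ∃ α : Fin n ≃ Fin n, (L.length : ℚ) / 3 + κ ≤
      (L.countP fun c => decide (c.SatisfiedBy α) : ℕ) := by
  classical
  by_contra! hcon
  have hpos : 0 < L.length := by
    by_contra h
    have : 0 < (2 ^ 15 * κ) ^ 2 := by positivity
    omega
  have hn : Nonempty (Fin n) := ⟨(L[0]).mid⟩
  -- The special variable must depend on the triple alone, so that constraints on the same triple
  -- share one weight product.
  have hsp : ∃ sp : Finset (Fin n) → Fin n, ∀ c ∈ L, sp c.vars ∈ c.vars ∧ sp c.vars ≠ c.mid := by
    have : ∀ T : Finset (Fin n), ∃ s, ∀ c ∈ L, c.vars = T → s ∈ T ∧ s ≠ c.mid := by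
      intro T
      by_cases hT : ∃ c ∈ L, c.vars = T
      · obtain ⟨c, hc, rfl⟩ := hT
        obtain ⟨s, hs, hs'⟩ := hL c hc
        exact ⟨s, fun d hd hdc => ⟨hs, hs' d hd hdc⟩⟩
      · exact ⟨Classical.arbitrary _, fun c hc hcT => absurd ⟨c, hc, hcT⟩ hT⟩
    choose sp hsp using this
    exact ⟨sp, fun c hc => hsp _ c hc rfl⟩
  obtain ⟨sp, hsp⟩ := hsp
  set c : Fin L.length → BetweennessConstraint n := fun i => L[i] with hc
  have hmem : ∀ i, c i ∈ L := fun i => List.getElem_mem _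
  set X : (Fin n → Fin 3) → ℝ := fun φ => ∑ i, (c i).gain φ with hX
  have hdeg : LowDeg n 3 X := LowDeg.sum _ _ fun i => (c i).lowDeg_gain
  have h0 : 𝔼 φ, X φ = 0 := by
    rw [hX, expect_sum_comm]
    exact sum_eq_zero fun i _ => (c i).expect_gain
  have hle : ∀ φ, X φ ≤ κ := by
    intro φ
    refine (sum_gain_eq_expect L φ).le.trans
      ((expect_le_expect (g := fun _ => (κ : ℝ)) fun π _ => ?_).trans (Fintype.expect_const _).le)
    have h2 := (Rat.cast_lt (K := ℝ)).2 (hcon (bucketOrdering φ π))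
    push_cast at h2
    linarith
  have h1 := card_le_expect_sq c sp (fun i => (hsp _ (hmem i)).1) fun i => (hsp _ (hmem i)).2
  have h2 := hdeg.expect_sq_le h0 (Nat.cast_pos.2 hκ) hle
  rw [Fintype.card_fin] at h1
  have h3 : ((2 : ℝ) ^ 15 * κ) ^ 2 ≤ 3 * L.length := by exact_mod_cast hlen
  have h4 : (1 : ℝ) ≤ (κ : ℝ) ^ 2 := by
    have : (1 : ℝ) ≤ κ := by exact_mod_cast hκ
    nlinarith
  -- The two moment bounds give `m ≤ 6561 * 2¹⁵ κ²`, whereas `hlen` says `m ≥ 2³⁰ κ² / 3`, which is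
  -- larger.
  have h5 := h1.trans h2
  nlinarith

end SecondMoment

/-! ### Cancelling triples of constraints. -/

section EraseTwo

variable {α : Type*}

/-- Moves `src` onto `acc`, leaving out the first element with `r₁` if `f₁` and the first one with
`r₂` if `f₂`. -/
def eraseTwo (r₁ r₂ : α → Bool) : Bool → Bool → List α → List α → List α
  | _, _, [], acc => acc
  | f₁, f₂, d :: src, acc =>
    if f₁ && r₁ d then eraseTwo r₁ r₂ false f₂ src acc
    else if f₂ && r₂ d then eraseTwo r₁ r₂ f₁ false src acc
    else eraseTwo r₁ r₂ f₁ f₂ src (d :: acc)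

theorem eraseTwo_false_false (r₁ r₂ : α → Bool) (src acc : List α) :
    eraseTwo r₁ r₂ false false src acc = src.reverse ++ acc := by
  induction src generalizing acc with
  | nil => rfl
  | cons d src ih => simp [eraseTwo, ih]

theorem eraseTwo_true_false_perm (r₁ r₂ : α → Bool) (src acc : List α) (h : src.any r₁) :
    ∃ d, r₁ d ∧ (src ++ acc).Perm (d :: eraseTwo r₁ r₂ true false src acc) := by
  induction src generalizing acc with
  | nil => simp at h
  | cons e src ih =>
    by_cases he : r₁ e
    · refine ⟨e, he, ?_⟩
      simp only [eraseTwo, he, Bool.and_self, if_true, eraseTwo_false_false, List.cons_append]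
      exact ((src.reverse_perm.symm).append_right _).cons _
    · obtain ⟨d, hd, hp⟩ := ih (e :: acc) (by simpa [he] using h)
      refine ⟨d, hd, ?_⟩
      simp only [eraseTwo, he]
      exact List.perm_middle.symm.trans hp

theorem eraseTwo_false_true_perm (r₁ r₂ : α → Bool) (src acc : List α) (h : src.any r₂) :
    ∃ d, r₂ d ∧ (src ++ acc).Perm (d :: eraseTwo r₁ r₂ false true src acc) := by
  induction src generalizing acc with
  | nil => simp at h
  | cons e src ih =>
    by_cases he : r₂ e
    · refine ⟨e, he, ?_⟩
      simp only [eraseTwo, he, Bool.and_self, if_true, eraseTwo_false_false, List.cons_append]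
      exact ((src.reverse_perm.symm).append_right _).cons _
    · obtain ⟨d, hd, hp⟩ := ih (e :: acc) (by simpa [he] using h)
      refine ⟨d, hd, ?_⟩
      simp only [eraseTwo, he]
      exact List.perm_middle.symm.trans hp

/-- Disjointness of the two tests ensures that the element removed for one test is not the only
witness for the other. -/
theorem eraseTwo_true_true_perm (r₁ r₂ : α → Bool) (src acc : List α)
    (hr : ∀ d, r₁ d → ¬ r₂ d) (h₁ : src.any r₁) (h₂ : src.any r₂) :
    ∃ d₁ d₂, r₁ d₁ ∧ r₂ d₂ ∧
      (src ++ acc).Perm (d₁ :: d₂ :: eraseTwo r₁ r₂ true true src acc) := by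
  induction src generalizing acc with
  | nil => simp at h₁
  | cons e src ih =>
    by_cases he₁ : r₁ e
    · obtain ⟨d, hd, hp⟩ := eraseTwo_false_true_perm r₁ r₂ src acc (by simpa [hr e he₁] using h₂)
      refine ⟨e, d, he₁, hd, ?_⟩
      simp only [eraseTwo, he₁, Bool.and_self, if_true, List.cons_append]
      exact hp.cons _
    · by_cases he₂ : r₂ e
      · obtain ⟨d, hd, hp⟩ := eraseTwo_true_false_perm r₁ r₂ src acc (by simpa [he₁] using h₁)
        refine ⟨d, e, hd, he₂, ?_⟩
        simp only [eraseTwo, he₁, he₂, Bool.and_self, if_true, List.cons_append]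
        exact (hp.cons e).trans (List.Perm.swap _ _ _)
      · obtain ⟨d₁, d₂, h1, h2, hp⟩ := ih (e :: acc) (by simpa [he₁] using h₁)
          (by simpa [he₂] using h₂)
        refine ⟨d₁, d₂, h1, h2, ?_⟩
        simp only [eraseTwo, he₁, he₂]
        exact List.perm_middle.symm.trans hp

end EraseTwo

namespace BetweennessConstraint

variable {n : ℕ}

/-- Whether `d` has the middle variable `b` and the outer variables `a` and `c`. -/
def isOn (b a c : Fin n) (d : BetweennessConstraint n) : Bool :=
  decide (d.mid = b) && ((decide (d.left = a) && decide (d.right = c)) ||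
    (decide (d.left = c) && decide (d.right = a)))

/-- Whether `d` is the constraint on the variables of `c` with `c.left` in the middle. -/
def isLeftMate (c d : BetweennessConstraint n) : Bool :=
  isOn c.left c.mid c.right d

/-- Whether `d` is the constraint on the variables of `c` with `c.right` in the middle. -/
def isRightMate (c d : BetweennessConstraint n) : Bool :=
  isOn c.right c.mid c.left d

/-- Adds a constraint to a list, cancelling it against the two other constraints on its variables
if they are both there. -/
def insertCancel (L : List (BetweennessConstraint n)) (c : BetweennessConstraint n) :
    List (BetweennessConstraint n) :=
  if L.any c.isLeftMate && L.any c.isRightMate then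
    eraseTwo c.isLeftMate c.isRightMate true true L.reverse []
  else c :: L

/-- The list that remains when triples of constraints on the same variables are cancelled. -/
def cancel (L : List (BetweennessConstraint n)) : List (BetweennessConstraint n) :=
  L.foldl insertCancel []

theorem isLeftMate_iff (c d : BetweennessConstraint n) :
    c.isLeftMate d ↔ d.vars = c.vars ∧ d.mid = c.left := by
  obtain ⟨u, v, w, h1, h2, h3⟩ := c
  obtain ⟨u', v', w', h1', h2', h3'⟩ := d
  simp only [isLeftMate, isOn, vars, Bool.and_eq_true, Bool.or_eq_true, decide_eq_true_eq]
  constructor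
  · rintro ⟨rfl, ⟨rfl, rfl⟩ | ⟨rfl, rfl⟩⟩
    · exact ⟨Finset.insert_comm _ _ _, rfl⟩
    · refine ⟨?_, rfl⟩
      ext x
      simp only [Finset.mem_insert, Finset.mem_singleton]
      tauto
  · rintro ⟨h, rfl⟩
    refine ⟨rfl, ?_⟩
    have hv : v' ∈ ({u, u', w} : Finset (Fin n)) := h ▸ by simp
    have hw : w' ∈ ({u, u', w} : Finset (Fin n)) := h ▸ by simp
    simp only [Finset.mem_insert, Finset.mem_singleton] at hv hw
    rcases hv with rfl | rfl | rfl <;> rcases hw with rfl | rfl | rfl <;> simp_all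

theorem isRightMate_iff (c d : BetweennessConstraint n) :
    c.isRightMate d ↔ d.vars = c.vars ∧ d.mid = c.right := by
  have h := isLeftMate_iff ⟨c.mid, c.right, c.left, c.mid_ne_right, c.mid_ne_left,
    c.left_ne_right.symm⟩ d
  have hv : c.vars = ({c.mid, c.right, c.left} : Finset (Fin n)) := by
    unfold vars
    rw [Finset.pair_comm]
  rw [hv]
  exact h

theorem not_isRightMate_of_isLeftMate (c d : BetweennessConstraint n) (h : c.isLeftMate d) :
    ¬ c.isRightMate d := by
  rw [isLeftMate_iff] at h
  rw [isRightMate_iff]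
  rintro ⟨_, h'⟩
  exact c.left_ne_right (h.2.symm.trans h')

/-- Every ordering satisfies exactly one of the three constraints on three variables. -/
theorem countP_mates (c d₁ d₂ : BetweennessConstraint n) (h₁ : c.isLeftMate d₁)
    (h₂ : c.isRightMate d₂) (α : Fin n ≃ Fin n) :
    [c, d₁, d₂].countP (fun c => decide (c.SatisfiedBy α)) = 1 := by
  obtain ⟨u, v, w, huv, huw, hvw⟩ := c
  obtain ⟨u₁, v₁, w₁, _, _, _⟩ := d₁
  obtain ⟨u₂, v₂, w₂, _, _, _⟩ := d₂
  simp only [isLeftMate, isRightMate, isOn, Bool.and_eq_true, Bool.or_eq_true,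
    decide_eq_true_eq] at h₁ h₂
  have e1 := α.injective.ne huv
  have e2 := α.injective.ne huw
  have e3 := α.injective.ne hvw
  simp only [List.countP_cons, List.countP_nil, SatisfiedBy]
  rcases lt_or_gt_of_ne e1 with h | h <;> rcases lt_or_gt_of_ne e2 with h' | h' <;>
    rcases lt_or_gt_of_ne e3 with h'' | h'' <;>
    first
      | (exfalso; omega)
      | (obtain ⟨rfl, ⟨rfl, rfl⟩ | ⟨rfl, rfl⟩⟩ := h₁ <;>
          obtain ⟨rfl, ⟨rfl, rfl⟩ | ⟨rfl, rfl⟩⟩ := h₂ <;>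
          simp [h, h', h'', h.not_gt, h'.not_gt, h''.not_gt])

/-- Here `k` is 1 if a triple is cancelled and 0 otherwise; by `countP_mates` a cancelled triple
contributes exactly 1 to every count. -/
theorem insertCancel_count (L : List (BetweennessConstraint n)) (c : BetweennessConstraint n) :
    ∃ k, (insertCancel L c).length + 3 * k = L.length + 1 ∧
      ∀ α : Fin n ≃ Fin n, (insertCancel L c).countP (fun c => decide (c.SatisfiedBy α)) + k =
        (c :: L).countP (fun c => decide (c.SatisfiedBy α)) := by
  unfold insertCancel
  split_ifs with h
  · simp only [Bool.and_eq_true] at h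
    obtain ⟨d₁, d₂, h1, h2, hp⟩ := eraseTwo_true_true_perm c.isLeftMate c.isRightMate L.reverse []
      (not_isRightMate_of_isLeftMate c) (by simpa using h.1) (by simpa using h.2)
    rw [List.append_nil] at hp
    have hp' := L.reverse_perm.symm.trans hp
    refine ⟨1, ?_, fun α => ?_⟩
    · rw [hp'.length_eq]
      simp
    · have hq := (hp'.cons c).countP_eq (fun c => decide (c.SatisfiedBy α))
      have hm := countP_mates c d₁ d₂ h1 h2 α
      rw [hq]
      simp only [List.countP_cons, List.countP_nil] at hm ⊢
      omega
  · exact ⟨0, by simp, fun α => by simp⟩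

theorem foldl_insertCancel_count (Cs L : List (BetweennessConstraint n)) :
    ∃ k, (Cs.foldl insertCancel L).length + 3 * k = L.length + Cs.length ∧
      ∀ α : Fin n ≃ Fin n,
        (Cs.foldl insertCancel L).countP (fun c => decide (c.SatisfiedBy α)) + k =
        L.countP (fun c => decide (c.SatisfiedBy α)) +
          Cs.countP (fun c => decide (c.SatisfiedBy α)) := by
  induction Cs generalizing L with
  | nil => exact ⟨0, by simp, fun α => by simp⟩
  | cons c Cs ih =>
    obtain ⟨k, h1, h2⟩ := ih (insertCancel L c)
    obtain ⟨k', h1', h2'⟩ := insertCancel_count L c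
    refine ⟨k + k', ?_, fun α => ?_⟩
    · simp only [List.foldl_cons, List.length_cons]
      omega
    · have h3 := h2 α
      have h4 := h2' α
      simp only [List.foldl_cons, List.countP_cons] at h4 ⊢
      omega

/-- On every set of three variables, some kind of constraint is missing. -/
def Irreducible (L : List (BetweennessConstraint n)) : Prop :=
  ∀ c ∈ L, ∃ s ∈ c.vars, ∀ d ∈ L, d.vars = c.vars → s ≠ d.mid

/-- Deletion keeps the property, as it passes to sublists. If `c` is added, one of its mates is
absent, and the middle variable of that mate stays unused as a middle on this triple. -/
theorem Irreducible.insertCancel {L : List (BetweennessConstraint n)} (hL : Irreducible L)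
    (c : BetweennessConstraint n) : Irreducible (insertCancel L c) := by
  unfold BetweennessConstraint.insertCancel
  split_ifs with h
  · simp only [Bool.and_eq_true] at h
    obtain ⟨d₁, d₂, -, -, hp⟩ := eraseTwo_true_true_perm c.isLeftMate c.isRightMate L.reverse []
      (not_isRightMate_of_isLeftMate c) (by simpa using h.1) (by simpa using h.2)
    rw [List.append_nil] at hp
    have hsub : ∀ e ∈ eraseTwo c.isLeftMate c.isRightMate true true L.reverse [], e ∈ L := by
      intro e he
      exact List.mem_reverse.1 (hp.symm.subset (by simp [he]))
    intro e he
    obtain ⟨s, hs, hs'⟩ := hL e (hsub e he)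
    exact ⟨s, hs, fun d hd => hs' d (hsub d hd)⟩
  · have hc : ∃ s ∈ c.vars, ∀ d ∈ c :: L, d.vars = c.vars → s ≠ d.mid := by
      rw [Bool.and_eq_true, not_and_or] at h
      rcases h with h | h
      · refine ⟨c.left, by simp [vars], fun d hd hdc hm => h ?_⟩
        rcases List.mem_cons.1 hd with rfl | hd
        · exact absurd hm.symm d.mid_ne_left
        · exact List.any_eq_true.2 ⟨d, hd, (isLeftMate_iff c d).2 ⟨hdc, hm.symm⟩⟩
      · refine ⟨c.right, by simp [vars], fun d hd hdc hm => h ?_⟩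
        rcases List.mem_cons.1 hd with rfl | hd
        · exact absurd hm.symm d.mid_ne_right
        · exact List.any_eq_true.2 ⟨d, hd, (isRightMate_iff c d).2 ⟨hdc, hm.symm⟩⟩
    intro e he
    by_cases hec : e.vars = c.vars
    · rw [hec]
      exact hc
    · have heL : e ∈ L := by
        rcases List.mem_cons.1 he with rfl | he
        · exact absurd rfl hec
        · exact he
      obtain ⟨s, hs, hs'⟩ := hL e heL
      refine ⟨s, hs, fun d hd hde => ?_⟩
      rcases List.mem_cons.1 hd with rfl | hd
      · exact absurd hde.symm hec
      · exact hs' d hd hde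

theorem irreducible_cancel (L : List (BetweennessConstraint n)) : Irreducible (cancel L) := by
  have h : ∀ (Cs L : List (BetweennessConstraint n)), Irreducible L →
      Irreducible (Cs.foldl BetweennessConstraint.insertCancel L) := by
    intro Cs
    induction Cs with
    | nil => exact fun L hL => hL
    | cons c Cs ih => exact fun L hL => ih _ (hL.insertCancel c)
  exact h L [] fun c hc => absurd hc List.not_mem_nil

end BetweennessConstraint

/-! ### Removing the variables that do not occur. -/

section Renaming

/-- Appends `x` unless it is already there. -/
def appendNew {α : Type*} [DecidableEq α] (D : List α) (x : α) : List α :=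
  if x ∈ D then D else D ++ [x]

/-- The different elements of a list. -/
def distinct {α : Type*} [DecidableEq α] (l : List α) : List α :=
  l.foldl appendNew []

variable {α : Type*} [DecidableEq α]

theorem prefix_foldl_appendNew (l D : List α) : D <+: l.foldl appendNew D := by
  induction l generalizing D with
  | nil => exact List.prefix_rfl
  | cons x l ih =>
    refine List.IsPrefix.trans ?_ (ih _)
    unfold appendNew
    split_ifs
    · exact List.prefix_rfl
    · exact List.prefix_append _ _

theorem mem_foldl_appendNew (l D : List α) (x : α) :
    x ∈ l.foldl appendNew D ↔ x ∈ D ∨ x ∈ l := by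
  induction l generalizing D with
  | nil => simp
  | cons y l ih =>
    rw [List.foldl_cons, ih]
    unfold appendNew
    split_ifs with h
    · simp only [List.mem_cons]
      constructor
      · tauto
      · rintro (h' | rfl | h') <;> tauto
    · simp only [List.mem_append, List.mem_cons, List.not_mem_nil, or_false]
      tauto

theorem nodup_foldl_appendNew (l D : List α) (hD : D.Nodup) : (l.foldl appendNew D).Nodup := by
  induction l generalizing D with
  | nil => exact hD
  | cons y l ih =>
    refine ih _ ?_
    unfold appendNew
    split_ifs with h
    · exact hD
    · rw [← List.concat_eq_append]
      exact hD.concat h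

theorem length_foldl_appendNew_le (l D : List α) :
    (l.foldl appendNew D).length ≤ D.length + l.length := by
  induction l generalizing D with
  | nil => simp
  | cons y l ih =>
    refine (ih _).trans ?_
    unfold appendNew
    split_ifs
    · simp
    · simp
      omega

end Renaming

namespace BetweennessConstraint

variable {n : ℕ}

/-- The variables of a list of constraints, in the order in which they are written. -/
def flatVars (L : List (BetweennessConstraint n)) : List (Fin n) :=
  L.flatMap fun c => [c.mid, c.left, c.right]

/-- The variables that occur in a list of constraints, each of them once. -/
def usedVars (L : List (BetweennessConstraint n)) : List (Fin n) :=
  distinct (flatVars L).reverse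

theorem length_flatVars (L : List (BetweennessConstraint n)) :
    (flatVars L).length = 3 * L.length := by
  induction L with
  | nil => rfl
  | cons c L ih =>
    simp only [flatVars, List.flatMap_cons, List.length_append, List.length_cons,
      List.length_nil] at ih ⊢
    omega

theorem mem_usedVars {L : List (BetweennessConstraint n)} {c : BetweennessConstraint n}
    (hc : c ∈ L) : c.mid ∈ usedVars L ∧ c.left ∈ usedVars L ∧ c.right ∈ usedVars L := by
  have h : ∀ x ∈ [c.mid, c.left, c.right], x ∈ usedVars L := by
    intro x hx
    unfold usedVars distinct
    rw [mem_foldl_appendNew, List.mem_reverse]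
    exact Or.inr (List.mem_flatMap.2 ⟨c, hc, hx⟩)
  exact ⟨h _ (by simp), h _ (by simp), h _ (by simp)⟩

theorem nodup_usedVars (L : List (BetweennessConstraint n)) : (usedVars L).Nodup :=
  nodup_foldl_appendNew _ _ List.nodup_nil

/-- The constraint `c` on the places of its variables in the list `D`. -/
def rename (D : List (Fin n)) (c : BetweennessConstraint n)
    (h : c.mid ∈ D ∧ c.left ∈ D ∧ c.right ∈ D) : BetweennessConstraint D.length where
  mid := ⟨D.idxOf c.mid, List.idxOf_lt_length_of_mem h.1⟩
  left := ⟨D.idxOf c.left, List.idxOf_lt_length_of_mem h.2.1⟩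
  right := ⟨D.idxOf c.right, List.idxOf_lt_length_of_mem h.2.2⟩
  mid_ne_left h' := c.mid_ne_left ((List.idxOf_inj h.1).1 (Fin.mk.inj_iff.1 h'))
  mid_ne_right h' := c.mid_ne_right ((List.idxOf_inj h.1).1 (Fin.mk.inj_iff.1 h'))
  left_ne_right h' := c.left_ne_right ((List.idxOf_inj h.2.1).1 (Fin.mk.inj_iff.1 h'))

/-- The instance with the constraints `L` and without superfluous variables. -/
def compress (L : List (BetweennessConstraint n)) : BetweennessInstance where
  numVars := (usedVars L).length
  constraints := L.pmap (rename (usedVars L)) fun _ hc => mem_usedVars hc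

theorem numSatisfied_compress (L : List (BetweennessConstraint n))
    (α : Fin n ≃ Fin n) (β : Fin (usedVars L).length ≃ Fin (usedVars L).length)
    (h : ∀ (u v : Fin n) (hu : u ∈ usedVars L) (hv : v ∈ usedVars L),
      β ⟨_, List.idxOf_lt_length_of_mem hu⟩ < β ⟨_, List.idxOf_lt_length_of_mem hv⟩ ↔
        α u < α v) :
    (compress L).numSatisfied β = L.countP fun c => decide (c.SatisfiedBy α) := by
  -- The list `D` is decoupled from the constraints for the induction, since `usedVars L` would
  -- change with `L`.
  have key : ∀ (D : List (Fin n)) (β : Fin D.length ≃ Fin D.length)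
      (_ : ∀ (u v : Fin n) (hu : u ∈ D) (hv : v ∈ D),
        β ⟨_, List.idxOf_lt_length_of_mem hu⟩ < β ⟨_, List.idxOf_lt_length_of_mem hv⟩ ↔
          α u < α v) (M : List (BetweennessConstraint n))
      (hM : ∀ c ∈ M, c.mid ∈ D ∧ c.left ∈ D ∧ c.right ∈ D),
      (M.pmap (rename D) hM).countP (fun c => decide (c.SatisfiedBy β)) =
        M.countP fun c => decide (c.SatisfiedBy α) := by
    intro D β hβ M hM
    induction M with
    | nil => rfl
    | cons c M ih =>
      have hc := hM c (by simp)
      have hsat : (rename D c hc).SatisfiedBy β ↔ c.SatisfiedBy α := by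
        simp only [SatisfiedBy, rename, hβ _ _ hc.1 hc.2.1, hβ _ _ hc.1 hc.2.2, hβ _ _ hc.2.1 hc.1,
          hβ _ _ hc.2.2 hc.1]
      rw [List.pmap_cons, List.countP_cons, List.countP_cons, ih, decide_eq_decide.2 hsat]
  exact key _ β h L _

/-- Satisfaction depends only on the relative order of the variables that occur. An ordering of
these extends by placing all others behind them; conversely an ordering of all variables restricts.
-/
theorem exists_ordering_compress_iff (L : List (BetweennessConstraint n)) (q : ℚ) :
    (∃ β, q ≤ ((compress L).numSatisfied β : ℚ)) ↔
      ∃ α : Fin n ≃ Fin n, q ≤ (L.countP fun c => decide (c.SatisfiedBy α) : ℕ) := by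
  set D := usedVars L with hD
  constructor
  · rintro ⟨β, hβ⟩
    let f : Fin n → ℕ := fun u =>
      if h : u ∈ D then β ⟨D.idxOf u, List.idxOf_lt_length_of_mem h⟩ else D.length + u
    have hf : Function.Injective f := by
      intro u v huv
      simp only [f] at huv
      split_ifs at huv with hu hv hv
      · have := β.injective (Fin.ext huv)
        exact (List.idxOf_inj hu).1 (Fin.mk.inj_iff.1 this)
      · have := (β ⟨D.idxOf u, List.idxOf_lt_length_of_mem hu⟩).isLt
        have e : (compress L).numVars = D.length := rfl
        omega
      · have := (β ⟨D.idxOf v, List.idxOf_lt_length_of_mem hv⟩).isLt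
        have e : (compress L).numVars = D.length := rfl
        omega
      · exact Fin.ext (by omega)
    obtain ⟨α, hα⟩ := exists_ordering_of_injective f hf
    refine ⟨α, ?_⟩
    rwa [← numSatisfied_compress L α β]
    intro u v hu hv
    rw [hα]
    simp only [f, hD, hu, hv, dif_pos]
    rfl
  · rintro ⟨α, hα⟩
    have hf : Function.Injective fun i : Fin D.length => (α D[i] : ℕ) := by
      intro i j hij
      have := α.injective (Fin.ext hij)
      exact Fin.ext ((nodup_usedVars L).getElem_inj_iff.1 this)
    obtain ⟨β, hβ⟩ := exists_ordering_of_injective _ hf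
    refine ⟨β, ?_⟩
    rwa [numSatisfied_compress L α β]
    intro u v hu hv
    rw [hβ]
    simp [hD]

end BetweennessConstraint

/-! ### The kernelization and its correctness. -/

open BetweennessConstraint

/-- The kernelization: cancel, answer yes if many constraints remain, and otherwise drop the
variables that no longer occur. -/
def kernelize (p : BetweennessInstance × ℕ) : BetweennessInstance × ℕ :=
  if (2 ^ 15 * p.2) ^ 2 ≤ 3 * (cancel p.1.constraints).length then (⟨0, []⟩, 0)
  else (compress (cancel p.1.constraints), p.2)

theorem mem_betweennessAA_iff_cancel (p : BetweennessInstance × ℕ) :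
    p ∈ BetweennessAA ↔ ∃ α : Fin p.1.numVars ≃ Fin p.1.numVars,
      ((cancel p.1.constraints).length : ℚ) / 3 + p.2 ≤
        ((cancel p.1.constraints).countP fun c => decide (c.SatisfiedBy α) : ℕ) := by
  obtain ⟨k, h1, h2⟩ := foldl_insertCancel_count p.1.constraints []
  unfold BetweennessAA
  rw [Set.mem_ofPred_eq]
  refine exists_congr fun α => ?_
  have h3 := h2 α
  simp only [List.countP_nil, List.length_nil, zero_add] at h1 h3
  change (cancel p.1.constraints).length + 3 * k = _ at h1
  change (cancel p.1.constraints).countP _ + k = _ at h3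
  unfold BetweennessInstance.numSatisfied
  rw [← h3, ← h1]
  push_cast
  constructor <;> intro h <;> linarith

theorem kernelize_mem_iff (p : BetweennessInstance × ℕ) :
    p ∈ BetweennessAA ↔ kernelize p ∈ BetweennessAA := by
  rw [mem_betweennessAA_iff_cancel]
  unfold kernelize
  split_ifs with h
  · have hyes : ((⟨0, []⟩, 0) : BetweennessInstance × ℕ) ∈ BetweennessAA :=
      ⟨Equiv.refl _, by simp⟩
    refine iff_of_true ?_ hyes
    -- For `κ = 0` the threshold is always met, however short the list, and the average alone
    -- suffices.
    rcases Nat.eq_zero_or_pos p.2 with h0 | h0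
    · rw [h0]
      simpa using exists_ordering_average (cancel p.1.constraints)
    · exact exists_ordering_above_average _ (irreducible_cancel _) h0 h
  · have := exists_ordering_compress_iff (cancel p.1.constraints)
      (((cancel p.1.constraints).length : ℚ) / 3 + p.2)
    rw [← this]
    unfold BetweennessAA
    rw [Set.mem_ofPred_eq]
    simp [compress]

theorem kernelize_param_le (p : BetweennessInstance × ℕ) : (kernelize p).2 ≤ p.2 := by
  unfold kernelize
  split_ifs <;> simp

theorem kernelize_size_le (p : BetweennessInstance × ℕ) :
    (kernelize p).1.size ≤ 2 ^ 31 * p.2 ^ 2 := by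
  unfold kernelize
  split_ifs with h
  · simp [BetweennessInstance.size]
  · have h1 := length_foldl_appendNew_le (flatVars (cancel p.1.constraints)).reverse []
    rw [List.length_reverse, length_flatVars] at h1
    have h2 : (compress (cancel p.1.constraints)).constraints.length =
        (cancel p.1.constraints).length := List.length_pmap
    have h3 : (compress (cancel p.1.constraints)).numVars ≤
        3 * (cancel p.1.constraints).length := h1.trans (by simp)
    simp only [BetweennessInstance.size]
    rw [mul_pow] at h
    -- Below the threshold `3 m < 2³⁰ κ²`; both the number of variables and `m` are at most `3 m`.
    omega

/-! ### Structured stack programs and their compilation to Turing machines. -/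

section StackPrograms

/-- Structured programs on stacks. Tests look at the tops of two stacks. -/
inductive StackProg (K Γ : Type) : Type
  | skip : StackProg K Γ
  | push (k : K) (a : Γ) : StackProg K Γ
  | pop (k : K) : StackProg K Γ
  | seq (p q : StackProg K Γ) : StackProg K Γ
  | ite (k l : K) (c : Option Γ → Option Γ → Bool) (p q : StackProg K Γ) : StackProg K Γ
  | loop (k l : K) (c : Option Γ → Option Γ → Bool) (p : StackProg K Γ) : StackProg K Γ

namespace StackProg

variable {K Γ : Type} [DecidableEq K]

/-- `Exec p s s' t`: the program `p` leads from the stacks `s` to the stacks `s'` in `t` steps. -/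
inductive Exec : StackProg K Γ → (K → List Γ) → (K → List Γ) → ℕ → Prop
  | skip (s) : Exec skip s s 1
  | push (k a s) : Exec (push k a) s (Function.update s k (a :: s k)) 1
  | pop (k s) : Exec (pop k) s (Function.update s k (s k).tail) 1
  | seq {p q s s' s'' t t'} : Exec p s s' t → Exec q s' s'' t' → Exec (seq p q) s s'' (t' + t)
  | ite_true {k l c p q s s' t} : c (s k).head? (s l).head? = true → Exec p s s' t →
      Exec (ite k l c p q) s s' (t + 1)
  | ite_false {k l c p q s s' t} : c (s k).head? (s l).head? = false → Exec q s s' t →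
      Exec (ite k l c p q) s s' (t + 1)
  | loop_false {k l c p s} : c (s k).head? (s l).head? = false → Exec (loop k l c p) s s 1
  | loop_true {k l c p s s' s'' t t'} : c (s k).head? (s l).head? = true → Exec p s s' t →
      Exec (loop k l c p) s' s'' t' → Exec (loop k l c p) s s'' (t' + t + 1)

/-- `Runs p s s' T`: the program `p` leads from `s` to `s'` in at most `T` steps. -/
def Runs (p : StackProg K Γ) (s s' : K → List Γ) (T : ℕ) : Prop :=
  ∃ t ≤ T, Exec p s s' t

/-- The labels of the Turing machine for a program. -/
def Label : StackProg K Γ → Type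
  | skip => Unit
  | push _ _ => Unit
  | pop _ => Unit
  | seq p q => Label p ⊕ Label q
  | ite _ _ _ p q => Option (Label p ⊕ Label q)
  | loop _ _ _ p => Option (Label p)

/-- The first label of a program. -/
def entry : (p : StackProg K Γ) → Label p
  | skip => ()
  | push _ _ => ()
  | pop _ => ()
  | seq p _ => Sum.inl (entry p)
  | ite _ _ _ _ _ => none
  | loop _ _ _ _ => none

/-- There are finitely many labels. -/
@[reducible]
def fintypeLabel : (p : StackProg K Γ) → Fintype (Label p)
  | skip => inferInstanceAs (Fintype Unit)
  | push _ _ => inferInstanceAs (Fintype Unit)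
  | pop _ => inferInstanceAs (Fintype Unit)
  | seq p q => @instFintypeSum _ _ (fintypeLabel p) (fintypeLabel q)
  | ite _ _ _ p q =>
    @instFintypeOption _ (@instFintypeSum _ _ (fintypeLabel p) (fintypeLabel q))
  | loop _ _ _ p => @instFintypeOption _ (fintypeLabel p)

open Turing in
/-- The statement at each label of a program that is embedded into a machine with labels `Λ` and
continues at `exit`. -/
def code {Λ : Type} : (p : StackProg K Γ) → (Label p → Λ) → Λ → Label p →
    TM2.Stmt (fun _ : K => Γ) Λ (Option Γ × Option Γ)
  | skip, _, exit, _ => TM2.Stmt.goto fun _ => exit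
  | push k a, _, exit, _ => TM2.Stmt.push k (fun _ => a) (TM2.Stmt.goto fun _ => exit)
  | pop k, _, exit, _ => TM2.Stmt.pop k (fun v _ => v) (TM2.Stmt.goto fun _ => exit)
  | seq p q, emb, exit, l =>
    match l with
    | Sum.inl l => code p (emb ∘ Sum.inl) (emb (Sum.inr (entry q))) l
    | Sum.inr l => code q (emb ∘ Sum.inr) exit l
  | ite k l c p q, emb, exit, m =>
    match m with
    | none => TM2.Stmt.peek k (fun v x => (x, v.2)) (TM2.Stmt.peek l (fun v x => (v.1, x))
        (TM2.Stmt.branch (fun v => c v.1 v.2)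
          (TM2.Stmt.goto fun _ => emb (some (Sum.inl (entry p))))
          (TM2.Stmt.goto fun _ => emb (some (Sum.inr (entry q))))))
    | some (Sum.inl m) => code p (emb ∘ some ∘ Sum.inl) exit m
    | some (Sum.inr m) => code q (emb ∘ some ∘ Sum.inr) exit m
  | loop k l c p, emb, exit, m =>
    match m with
    | none => TM2.Stmt.peek k (fun v x => (x, v.2)) (TM2.Stmt.peek l (fun v x => (v.1, x))
        (TM2.Stmt.branch (fun v => c v.1 v.2) (TM2.Stmt.goto fun _ => emb (some (entry p)))
          (TM2.Stmt.goto fun _ => exit)))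
    | some m => code p (emb ∘ some) (emb none) m

/-- The machine leads from `c` to `c'` in `t` steps. -/
def StepsTo {Λ σ : Type} (M : Λ → Turing.TM2.Stmt (fun _ : K => Γ) Λ σ) (t : ℕ)
    (c c' : Turing.TM2.Cfg (fun _ : K => Γ) Λ σ) : Prop :=
  (flip bind (Turing.TM2.step M))^[t] (some c) = some c'

theorem StepsTo.trans {Λ σ : Type} {M : Λ → Turing.TM2.Stmt (fun _ : K => Γ) Λ σ} {t t' : ℕ}
    {c c' c'' : Turing.TM2.Cfg (fun _ : K => Γ) Λ σ} (h : StepsTo M t c c')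
    (h' : StepsTo M t' c' c'') : StepsTo M (t' + t) c c'' := by
  unfold StepsTo at *
  rw [Function.iterate_add_apply, h, h']

theorem StepsTo.one {Λ σ : Type} {M : Λ → Turing.TM2.Stmt (fun _ : K => Γ) Λ σ}
    {c c' : Turing.TM2.Cfg (fun _ : K => Γ) Λ σ} (h : Turing.TM2.step M c = some c') :
    StepsTo M 1 c c' := h

/-- Induction on the execution, for every embedding of the labels and every exit, since a subprogram
sits inside a larger one. The register contents `v` are arbitrary: each test reloads both registers
by peeking before it branches. -/
theorem Exec.stepsTo {Λ : Type} (M : Λ → Turing.TM2.Stmt (fun _ : K => Γ) Λ (Option Γ × Option Γ))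
    {p : StackProg K Γ} {s s' : K → List Γ} {t : ℕ} (h : Exec p s s' t) (emb : Label p → Λ)
    (exit : Λ) (hM : ∀ l, M (emb l) = code p emb exit l) (v : Option Γ × Option Γ) :
    ∃ v', StepsTo M t ⟨some (emb (entry p)), v, s⟩ ⟨some exit, v', s'⟩ := by
  induction h generalizing v exit with
  | skip s => exact ⟨v, StepsTo.one (by simp [hM, code])⟩
  | push k a s => exact ⟨v, StepsTo.one (by simp [hM, code])⟩
  | pop k s => exact ⟨v, StepsTo.one (by simp [hM, code])⟩
  | @seq p q s s' s'' t t' _ _ ih ih' =>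
    obtain ⟨v', h'⟩ := ih (emb ∘ Sum.inl) (emb (Sum.inr (entry q))) (fun l => hM (Sum.inl l)) v
    obtain ⟨v'', h''⟩ := ih' (emb ∘ Sum.inr) exit (fun l => hM (Sum.inr l)) v'
    exact ⟨v'', h'.trans h''⟩
  | @ite_true k l c p q s s' t hc _ ih =>
    obtain ⟨v', h'⟩ := ih (emb ∘ some ∘ Sum.inl) exit (fun l => hM (some (Sum.inl l)))
      ((s k).head?, (s l).head?)
    refine ⟨v', StepsTo.trans (StepsTo.one ?_) h'⟩
    change some (Turing.TM2.stepAux (M (emb (entry (ite k l c p q)))) v s) = _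
    rw [hM]
    simp [code, entry, hc, Function.comp_apply]
    rfl
  | @ite_false k l c p q s s' t hc _ ih =>
    obtain ⟨v', h'⟩ := ih (emb ∘ some ∘ Sum.inr) exit (fun l => hM (some (Sum.inr l)))
      ((s k).head?, (s l).head?)
    refine ⟨v', StepsTo.trans (StepsTo.one ?_) h'⟩
    change some (Turing.TM2.stepAux (M (emb (entry (ite k l c p q)))) v s) = _
    rw [hM]
    simp [code, entry, hc, Function.comp_apply]
    rfl
  | @loop_false k l c p s hc =>
    refine ⟨((s k).head?, (s l).head?), StepsTo.one ?_⟩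
    change some (Turing.TM2.stepAux (M (emb (entry (loop k l c p)))) v s) = _
    rw [hM]
    simp [code, entry, hc]
  | @loop_true k l c p s s' s'' t t' hc _ _ ih ih' =>
    obtain ⟨v', h'⟩ := ih (emb ∘ some) (emb none) (fun l => hM (some l))
      ((s k).head?, (s l).head?)
    obtain ⟨v'', h''⟩ := ih' emb exit hM v'
    refine ⟨v'', StepsTo.trans (StepsTo.one ?_) (h'.trans h'')⟩
    change some (Turing.TM2.stepAux (M (emb (entry (loop k l c p)))) v s) = _
    rw [hM]
    simp [code, entry, hc]
    rfl

/-- The Turing machine that runs a program and halts. -/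
def machine [Fintype K] [Fintype Γ] (p : StackProg K Γ) (kin kout : K) : Turing.FinTM2 :=
  letI := fintypeLabel p
  { K := K
    k₀ := kin
    k₁ := kout
    Γ := fun _ => Γ
    Λ := Option (Label p)
    main := some (entry p)
    σ := Option Γ × Option Γ
    initialState := (none, none)
    m := fun l =>
      match l with
      -- A halting configuration must carry the initial registers, which the program may have
      -- altered. This last step is the `+ 1` in the running time.
      | none => Turing.TM2.Stmt.load (fun _ => (none, none)) Turing.TM2.Stmt.halt
      | some l => code p some none l }

theorem initList_machine [Fintype K] [Fintype Γ] (p : StackProg K Γ) (kin kout : K) (l : List Γ) :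
    Turing.initList (machine p kin kout) l =
      ⟨some (some (entry p)), (none, none), Function.update (fun _ => []) kin l⟩ := by
  refine congrArg (Turing.TM2.Cfg.mk (some (some (entry p))) (none, none)) ?_
  funext (k : K)
  by_cases hk : k = kin
  · subst hk
    exact (dif_pos rfl).trans (Function.update_self (β := fun _ => List Γ) k l fun _ => []).symm
  · exact (dif_neg hk).trans (Function.update_of_ne (β := fun _ => List Γ) hk l fun _ => []).symm

theorem haltList_machine [Fintype K] [Fintype Γ] (p : StackProg K Γ) (kin kout : K) (l : List Γ) :
    Turing.haltList (machine p kin kout) l =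
      ⟨none, (none, none), Function.update (fun _ => []) kout l⟩ := by
  refine congrArg (Turing.TM2.Cfg.mk none (none, none)) ?_
  funext (k : K)
  by_cases hk : k = kout
  · subst hk
    exact (dif_pos rfl).trans (Function.update_self (β := fun _ => List Γ) k l fun _ => []).symm
  · exact (dif_neg hk).trans (Function.update_of_ne (β := fun _ => List Γ) hk l fun _ => []).symm

/-- A function computed by a program with polynomial running time is computed by a Turing machine
in polynomial time. -/
theorem nonempty_computableInPolyTime [Fintype K] [Fintype Γ] {α β : Type} (p : StackProg K Γ)
    (kin kout : K) (ea : α → List Γ) (eb : β → List Γ) (f : α → β) (time : Polynomial ℕ)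
    (h : ∀ a, Runs p (Function.update (fun _ => []) kin (ea a))
      (Function.update (fun _ => []) kout (eb (f a))) (time.eval (ea a).length)) :
    Nonempty (Turing.TM2ComputableInPolyTime ea eb f) := by
  refine ⟨{ tm := machine p kin kout, inputAlphabet := Equiv.refl Γ,
            outputAlphabet := Equiv.refl Γ, time := time + 1, outputsFun := fun a => ?_ }⟩
  have hrun := h a
  let t := hrun.choose
  have ht : t ≤ _ := hrun.choose_spec.1
  have hex := hrun.choose_spec.2
  refine { steps := t + 1, evals_in_steps := ?_, steps_le_m := ?_ }
  · obtain ⟨v, hv⟩ := hex.stepsTo (machine p kin kout).m some none (fun _ => rfl) (none, none)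
    have key : ∀ l l' : List Γ, l = ea a → l' = eb (f a) →
        StepsTo (machine p kin kout).m (t + 1) (Turing.initList (machine p kin kout) l)
          (Turing.haltList (machine p kin kout) l') := by
      rintro _ _ rfl rfl
      have e1 := initList_machine p kin kout (ea a)
      have e2 := haltList_machine p kin kout (eb (f a))
      rw [Nat.add_comm]
      exact e1 ▸ e2 ▸ StepsTo.trans hv (StepsTo.one rfl)
    exact key _ _ (List.map_id _) (List.map_id _)
  · simpa using ht

end StackProg

end StackPrograms

/-! ### Basic programs on unary numbers. -/

/-- The stacks of the kernelization program. -/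
inductive KStack
  | inp | out | bits | bits' | lst | lst' | dic | dic' | ra | rb | rc | rx | ry | rz | tmp
  | f₁ | f₂ | cnt | val | val' | prod
  deriving DecidableEq

instance KStack.instFintype : Fintype KStack where
  elems := {inp, out, bits, bits', lst, lst', dic, dic', ra, rb, rc, rx, ry, rz, tmp, f₁, f₂, cnt,
    val, val', prod}
  complete := by
    intro x
    cases x <;> decide

namespace StackProg

open InstanceSymbol Function

abbrev KProg := StackProg KStack InstanceSymbol

abbrev KState := KStack → List InstanceSymbol

section Rules

variable {K Γ : Type} [DecidableEq K]

theorem Runs.of_eq {p : StackProg K Γ} {s s' s'' : K → List Γ} {T T' : ℕ} (h : Runs p s s' T)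
    (hs : s' = s'') (hT : T ≤ T') : Runs p s s'' T' := by
  obtain ⟨t, ht, hex⟩ := h
  exact ⟨t, ht.trans hT, hs ▸ hex⟩

theorem Runs.mono {p : StackProg K Γ} {s s' : K → List Γ} {T T' : ℕ} (h : Runs p s s' T)
    (hT : T ≤ T') : Runs p s s' T' :=
  h.of_eq rfl hT

theorem Runs.seq {p q : StackProg K Γ} {s s' s'' : K → List Γ} {T T' : ℕ} (h : Runs p s s' T)
    (h' : Runs q s' s'' T') : Runs (seq p q) s s'' (T + T') := by
  obtain ⟨t, ht, hex⟩ := h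
  obtain ⟨t', ht', hex'⟩ := h'
  exact ⟨t' + t, by omega, hex.seq hex'⟩

theorem Runs.skip (s : K → List Γ) : Runs skip s s 1 := ⟨1, le_rfl, Exec.skip s⟩

theorem Runs.push (k : K) (a : Γ) (s : K → List Γ) : Runs (push k a) s (update s k (a :: s k)) 1 :=
  ⟨1, le_rfl, Exec.push k a s⟩

theorem Runs.pop (k : K) (s : K → List Γ) : Runs (pop k) s (update s k (s k).tail) 1 :=
  ⟨1, le_rfl, Exec.pop k s⟩

theorem Runs.ite_true {k l : K} {c : Option Γ → Option Γ → Bool} {p q : StackProg K Γ}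
    {s s' : K → List Γ} {T : ℕ} (hc : c (s k).head? (s l).head? = true) (h : Runs p s s' T) :
    Runs (ite k l c p q) s s' (T + 1) := by
  obtain ⟨t, ht, hex⟩ := h
  exact ⟨t + 1, by omega, hex.ite_true hc⟩

theorem Runs.ite_false {k l : K} {c : Option Γ → Option Γ → Bool} {p q : StackProg K Γ}
    {s s' : K → List Γ} {T : ℕ} (hc : c (s k).head? (s l).head? = false) (h : Runs q s s' T) :
    Runs (ite k l c p q) s s' (T + 1) := by
  obtain ⟨t, ht, hex⟩ := h
  exact ⟨t + 1, by omega, hex.ite_false hc⟩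

theorem Runs.loop_false {k l : K} {c : Option Γ → Option Γ → Bool} {p : StackProg K Γ}
    {s : K → List Γ} (hc : c (s k).head? (s l).head? = false) : Runs (loop k l c p) s s 1 :=
  ⟨1, le_rfl, Exec.loop_false hc⟩

theorem Runs.loop_true {k l : K} {c : Option Γ → Option Γ → Bool} {p : StackProg K Γ}
    {s s' s'' : K → List Γ} {T T' : ℕ} (hc : c (s k).head? (s l).head? = true)
    (h : Runs p s s' T) (h' : Runs (loop k l c p) s' s'' T') :
    Runs (loop k l c p) s s'' (T + T' + 1) := by
  obtain ⟨t, ht, hex⟩ := h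
  obtain ⟨t', ht', hex'⟩ := h'
  exact ⟨t' + t + 1, by omega, hex.loop_true hc hex'⟩

/-- The test whether a stack is nonempty. -/
def nonemptyTest : Option Γ → Option Γ → Bool := fun x _ => x.isSome

/-- The test whether two stacks are nonempty. -/
def bothTest : Option Γ → Option Γ → Bool := fun x y => x.isSome && y.isSome

/-- Empties a stack. -/
def clear (k : K) : StackProg K Γ := loop k k nonemptyTest (pop k)

theorem clear_runs (k : K) (s : K → List Γ) :
    Runs (clear k) s (update s k []) (2 * (s k).length + 1) := by
  generalize hl : s k = l
  induction l generalizing s with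
  | nil =>
    refine (Runs.loop_false (by simp [hl, nonemptyTest])).of_eq ?_ (by simp)
    rw [← hl, update_eq_self]
  | cons a l ih =>
    refine (Runs.loop_true (by simp [hl, nonemptyTest]) (Runs.pop k s)
      (ih (update s k (s k).tail) (by simp [hl]))).of_eq (by simp) ?_
    simp only [List.length_cons]
    omega

/-- Runs a program a fixed number of times. -/
def rep (p : StackProg K Γ) : ℕ → StackProg K Γ
  | 0 => skip
  | n + 1 => seq p (rep p n)

end Rules

/-- The test whether the top symbol is a stroke. -/
def oneTest : Option InstanceSymbol → Option InstanceSymbol → Bool :=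
  fun x _ => decide (x = some one)

/-- A number in unary, without separator. -/
def ones (n : ℕ) : List InstanceSymbol := List.replicate n one

theorem ones_succ (n : ℕ) : ones (n + 1) = one :: ones n := rfl

theorem ones_append_cons (n : ℕ) (l : List InstanceSymbol) :
    ones n ++ one :: l = one :: (ones n ++ l) := by
  induction n with
  | zero => rfl
  | succ n ih => rw [ones_succ, List.cons_append, ih, List.cons_append]

theorem length_ones (n : ℕ) : (ones n).length = n := List.length_replicate

theorem unary_eq (n : ℕ) : unary n = ones n ++ [sep] := rfl

/-- Moves strokes from one stack to another one. -/
def moveOnes (a b : KStack) : KProg := loop a a oneTest (seq (pop a) (push b one))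

theorem moveOnes_runs {a b : KStack} (hab : a ≠ b) (n : ℕ) (r : List InstanceSymbol)
    (hr : r.head? ≠ some one) (s : KState) (hs : s a = ones n ++ r) :
    Runs (moveOnes a b) s (update (update s a r) b (ones n ++ s b)) (3 * n + 1) := by
  induction n generalizing s with
  | zero =>
    have hs' : s a = r := hs
    refine (Runs.loop_false (by simp [hs', oneTest, hr])).of_eq ?_ (by simp)
    rw [← hs', update_eq_self]
    simp [ones]
  | succ n ih =>
    refine (Runs.loop_true (by simp [hs, oneTest, ones_succ])
      ((Runs.pop a s).seq (Runs.push b one _))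
      (ih _ (by simp [hab, hs, ones_succ]))).of_eq ?_ (by omega)
    simp [hab.symm, ones_succ, ones_append_cons, update_comm hab]

/-- Takes a number from a list. -/
def popBlock (l x : KStack) : KProg := seq (moveOnes l x) (pop l)

theorem popBlock_runs {l x : KStack} (h : l ≠ x) (n : ℕ) (r : List InstanceSymbol) (s : KState)
    (hl : s l = unary n ++ r) (hx : s x = []) :
    Runs (popBlock l x) s (update (update s l r) x (ones n)) (3 * n + 2) := by
  refine ((moveOnes_runs h n (sep :: r) (by simp) s (by simp [hl, unary_eq])).seq
    (Runs.pop l _)).of_eq ?_ (by omega)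
  simp [h, hx, update_comm h]

/-- Puts a number onto a list. -/
def pushBlock (x l : KStack) : KProg := seq (push l sep) (moveOnes x l)

theorem pushBlock_runs {l x : KStack} (h : x ≠ l) (n : ℕ) (s : KState) (hx : s x = ones n) :
    Runs (pushBlock x l) s (update (update s x []) l (unary n ++ s l)) (3 * n + 2) := by
  refine ((Runs.push l sep s).seq (moveOnes_runs h n [] (by simp) _ (by simp [h, hx]))).of_eq ?_
    (by omega)
  simp [unary_eq, update_comm h]

/-- Moves strokes from `tmp` back to two other stacks. -/
def restore (x y : KStack) : KProg :=
  loop KStack.tmp KStack.tmp nonemptyTest (seq (pop KStack.tmp) (seq (push x one) (push y one)))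

theorem restore_runs {x y : KStack} (hxy : x ≠ y) (hx : x ≠ KStack.tmp) (hy : y ≠ KStack.tmp)
    (n : ℕ) (s : KState) (hs : s KStack.tmp = ones n) :
    Runs (restore x y) s
      (update (update (update s KStack.tmp []) x (ones n ++ s x)) y (ones n ++ s y))
      (4 * n + 1) := by
  induction n generalizing s with
  | zero =>
    refine (Runs.loop_false (by simp [hs, nonemptyTest, ones])).of_eq ?_ (by simp)
    have hs' : s KStack.tmp = [] := hs
    rw [← hs', update_eq_self]
    simp [ones]
  | succ n ih =>
    refine (Runs.loop_true (by simp [hs, nonemptyTest, ones_succ])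
      ((Runs.pop KStack.tmp s).seq ((Runs.push x one _).seq (Runs.push y one _)))
      (ih _ (by simp [hx.symm, hy.symm, hs, ones_succ]))).of_eq ?_ (by omega)
    funext k
    simp only [update_apply]
    split_ifs <;> simp_all [ones_succ, ones_append_cons]

/-- Removes strokes from two stacks as long as possible and counts them on `tmp`. -/
def cancelOnes (x y : KStack) : KProg :=
  loop x y bothTest (seq (pop x) (seq (pop y) (push KStack.tmp one)))

/-- The numbers are written as a common part `n` plus remainders; `hab` makes `n` their minimum,
which is when the loop stops. -/
theorem cancelOnes_runs {x y : KStack} (hxy : x ≠ y) (hx : x ≠ KStack.tmp) (hy : y ≠ KStack.tmp)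
    (n a b : ℕ) (hab : a = 0 ∨ b = 0) (s : KState) (hsx : s x = ones (n + a))
    (hsy : s y = ones (n + b)) :
    Runs (cancelOnes x y) s
      (update (update (update s KStack.tmp (ones n ++ s KStack.tmp)) x (ones a)) y (ones b))
      (4 * n + 1) := by
  induction n generalizing s with
  | zero =>
    rw [Nat.zero_add] at hsx hsy
    refine (Runs.loop_false ?_).of_eq ?_ (by simp)
    · rcases hab with rfl | rfl <;> simp [hsx, hsy, bothTest, ones]
    · funext k
      simp only [update_apply]
      split_ifs <;> simp_all [ones]
  | succ n ih =>
    have ea : n + 1 + a = n + a + 1 := by omega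
    have eb : n + 1 + b = n + b + 1 := by omega
    rw [ea] at hsx
    rw [eb] at hsy
    refine (Runs.loop_true (by simp [hsx, hsy, bothTest, ones_succ])
      ((Runs.pop x s).seq ((Runs.pop y _).seq (Runs.push KStack.tmp one _)))
      (ih _ (by simp [hx, hxy, hsx, ones_succ]) (by simp [hy, hxy.symm, hsy, ones_succ]))).of_eq ?_
      (by omega)
    funext k
    simp only [update_apply]
    split_ifs <;> simp_all [ones_succ, ones_append_cons]

/-- Tests whether the numbers on two stacks are equal. -/
def ifEq (x y : KStack) (p q : KProg) : KProg :=
  seq (cancelOnes x y) (ite x y (fun u v => u.isNone && v.isNone) (seq (restore x y) p)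
    (seq (restore x y) q))

/-- The numbers agree exactly when nothing remains after the common part is removed. That part is
kept on `tmp` and put back, so both branches start from the unchanged state `s`. -/
theorem ifEq_runs {x y : KStack} (hxy : x ≠ y) (hx : x ≠ KStack.tmp) (hy : y ≠ KStack.tmp) (a b : ℕ)
    {p q : KProg} {s s' : KState} {T : ℕ} (hsx : s x = ones a) (hsy : s y = ones b)
    (ht : s KStack.tmp = []) (hp : a = b → Runs p s s' T) (hq : a ≠ b → Runs q s s' T) :
    Runs (ifEq x y p q) s s' (T + 8 * a + 3) := by
  obtain ⟨n, c, d, hcd, rfl, rfl⟩ : ∃ n c d, (c = 0 ∨ d = 0) ∧ a = n + c ∧ b = n + d :=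
    ⟨min a b, a - min a b, b - min a b, by omega, by omega, by omega⟩
  have h1 := cancelOnes_runs hxy hx hy n c d hcd s hsx hsy
  have h2 := restore_runs hxy hx hy n
    (update (update (update s KStack.tmp (ones n ++ s KStack.tmp)) x (ones c)) y (ones d))
    (by simp [hx.symm, hy.symm, ht])
  have h3 : update (update (update (update (update (update s KStack.tmp (ones n ++ s KStack.tmp))
      x (ones c)) y (ones d)) KStack.tmp [])
      x (ones n ++ update (update (update s KStack.tmp (ones n ++ s KStack.tmp))
        x (ones c)) y (ones d) x))
      y (ones n ++ update (update (update s KStack.tmp (ones n ++ s KStack.tmp))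
        x (ones c)) y (ones d) y) = s := by
    have e : ∀ m, ones n ++ ones m = ones (n + m) := fun m => List.replicate_append_replicate
    funext k
    simp only [update_apply]
    split_ifs <;> simp_all
  rw [h3] at h2
  by_cases hab : n + c = n + d
  · obtain rfl : c = 0 := by omega
    obtain rfl : d = 0 := by omega
    refine (h1.seq (Runs.ite_true ?_ (h2.seq (hp rfl)))).mono (by omega)
    simp [hxy, ones]
  · refine (h1.seq (Runs.ite_false ?_ (h2.seq (hq hab)))).mono (by omega)
    rcases c with _ | c
    · rcases d with _ | d
      · exact absurd rfl hab
      · simp [hxy, ones]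
    · simp [hxy, ones]

end StackProg

/-! ### Reading and cancelling constraints on the machine. -/

namespace StackProg

open InstanceSymbol Function BetweennessConstraint

/-- A list of numbers, each of them in unary with a separator. -/
def encNums (l : List ℕ) : List InstanceSymbol := l.flatMap unary

theorem encNums_cons (a : ℕ) (l : List ℕ) : encNums (a :: l) = unary a ++ encNums l := by
  simp [encNums]

theorem encNums_append (l l' : List ℕ) : encNums (l ++ l') = encNums l ++ encNums l' := by
  simp [encNums]

theorem isSome_head?_unary_append (a : ℕ) (l : List InstanceSymbol) :
    (unary a ++ l).head?.isSome = true := by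
  simp [unary]

/-- The code of a list of constraints. -/
def encCs {n : ℕ} (L : List (BetweennessConstraint n)) : List InstanceSymbol :=
  L.flatMap BetweennessConstraint.encode

theorem encCs_cons {n : ℕ} (c : BetweennessConstraint n) (L : List (BetweennessConstraint n)) :
    encCs (c :: L) = unary c.mid ++ (unary c.left ++ (unary c.right ++ encCs L)) := by
  simp [encCs, BetweennessConstraint.encode]

theorem encCs_eq_encNums {n : ℕ} (L : List (BetweennessConstraint n)) :
    encCs L = encNums ((flatVars L).map Fin.val) := by
  induction L with
  | nil => rfl
  | cons c L ih =>
    rw [encCs_cons, ih]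
    simp [flatVars, encNums]

/-- Takes three numbers from a list. -/
def popTriple (l x y z : KStack) : KProg := seq (popBlock l x) (seq (popBlock l y) (popBlock l z))

theorem popTriple_runs {l x y z : KStack} (hx : l ≠ x) (hy : l ≠ y) (hz : l ≠ z) (hxy : x ≠ y)
    (hxz : x ≠ z) (hyz : y ≠ z) {N a b c : ℕ} (ha : a ≤ N) (hb : b ≤ N) (hc : c ≤ N)
    (r : List InstanceSymbol) (s : KState) (hl : s l = unary a ++ (unary b ++ (unary c ++ r)))
    (ex : s x = []) (ey : s y = []) (ez : s z = []) :
    Runs (popTriple l x y z) s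
      (update (update (update (update s l r) x (ones a)) y (ones b)) z (ones c)) (9 * N + 6) := by
  refine ((popBlock_runs hx a _ s hl ex).seq ((popBlock_runs hy b (unary c ++ r) _
    (by simp [hx]) (by simp [ey, hxy.symm, hy.symm])).seq (popBlock_runs hz c r _
    (by simp [hy]) (by simp [ez, hxz.symm, hyz.symm, hz.symm])))).of_eq ?_ (by omega)
  funext k
  simp only [update_apply]
  split_ifs <;> simp_all

/-- Puts three numbers onto a list. -/
def pushTriple (x y z l : KStack) : KProg :=
  seq (pushBlock z l) (seq (pushBlock y l) (pushBlock x l))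

theorem pushTriple_runs {l x y z : KStack} (hx : l ≠ x) (hy : l ≠ y) (hz : l ≠ z) (hxy : x ≠ y)
    (hxz : x ≠ z) (hyz : y ≠ z) {N a b c : ℕ} (ha : a ≤ N) (hb : b ≤ N) (hc : c ≤ N) (s : KState)
    (ex : s x = ones a) (ey : s y = ones b) (ez : s z = ones c) :
    Runs (pushTriple x y z l) s
      (update (update (update (update s x []) y []) z [])
        l (unary a ++ (unary b ++ (unary c ++ s l)))) (9 * N + 6) := by
  refine ((pushBlock_runs hz.symm c s ez).seq ((pushBlock_runs hy.symm b _
    (by simp [hyz, hy.symm, ey])).seq (pushBlock_runs hx.symm a _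
    (by simp [hxy, hxz, hx.symm, ex])))).of_eq ?_ (by omega)
  funext k
  simp only [update_apply]
  split_ifs <;> simp_all

theorem ifEq_runs_le {x y : KStack} (hxy : x ≠ y) (hx : x ≠ .tmp) (hy : y ≠ .tmp) {N a b : ℕ}
    {p q : KProg} {s s' : KState} {T T' : ℕ} (ha : a ≤ N) (hsx : s x = ones a)
    (hsy : s y = ones b) (ht : s .tmp = []) (hT : T + (8 * N + 3) ≤ T')
    (hp : a = b → Runs p s s' T) (hq : a ≠ b → Runs q s s' T) :
    Runs (ifEq x y p q) s s' T' :=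
  (ifEq_runs hxy hx hy a b hsx hsy ht hp hq).mono (by omega)

/-- Tests whether the constraint on `rx`, `ry` and `rz` has the middle variable on `b` and the
outer variables on `a` and `c`. -/
def isOnTest (b a c : KStack) (p q : KProg) : KProg :=
  ifEq .rx b
    (ifEq .ry a (ifEq .rz c p (ifEq .ry c (ifEq .rz a p q) q)) (ifEq .ry c (ifEq .rz a p q) q)) q

theorem isOnTest_runs {b a c : KStack} (hb : b ≠ .rx ∧ b ≠ .tmp)
    (ha : a ≠ .ry ∧ a ≠ .rz ∧ a ≠ .tmp) (hc : c ≠ .ry ∧ c ≠ .rz ∧ c ≠ .tmp)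
    {n : ℕ} {u v w : Fin n} (d : BetweennessConstraint n) {p q : KProg} {s s' : KState} {T : ℕ}
    (ex : s .rx = ones d.mid) (ey : s .ry = ones d.left) (ez : s .rz = ones d.right)
    (eb : s b = ones u) (ea : s a = ones v) (ec : s c = ones w) (ht : s .tmp = [])
    (hp : isOn u v w d = true → Runs p s s' T) (hq : isOn u v w d = false → Runs q s s' T) :
    Runs (isOnTest b a c p q) s s' (T + (40 * n + 15)) := by
  have h1 := d.mid.isLt.le
  have h2 := d.left.isLt.le
  have h3 := d.right.isLt.le
  have hpq : (d.mid = u ∧ d.left = w ∧ d.right = v → Runs p s s' T) := fun h =>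
    hp (by simp [isOn, h])
  have hr : d.mid = u → ¬ (d.left = v ∧ d.right = w) →
      Runs (ifEq .ry c (ifEq .rz a p q) q) s s' (T + (16 * n + 6)) := by
    intro h0 h
    refine ifEq_runs_le (T := T + (8 * n + 3)) hc.1.symm (by decide) hc.2.2 h2 ey ec ht (by omega)
      (fun hyc => ?_) (fun hyc => ?_)
    · refine ifEq_runs_le (T := T) ha.2.1.symm (by decide) ha.2.2 h3 ez ea ht (by omega)
        (fun hza => ?_) (fun hza => ?_)
      · exact hp (by simp [isOn, h0, Fin.ext hyc, Fin.ext hza])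
      · have hza' : d.right ≠ v := fun h => hza (congrArg Fin.val h)
        refine hq ?_
        simp only [isOn, hza']
        simp [h0]
        tauto
    · have hyc' : d.left ≠ w := fun h => hyc (congrArg Fin.val h)
      refine (hq ?_).mono (by omega)
      simp only [isOn, hyc']
      simp [h0]
      tauto
  refine ifEq_runs_le (T := T + (32 * n + 12)) hb.1.symm (by decide) hb.2 h1 ex eb ht (by omega)
    (fun hxb => ?_) (fun hxb => ?_)
  · refine ifEq_runs_le (T := T + (24 * n + 9)) ha.1.symm (by decide) ha.2.2 h2 ey ea ht (by omega)
      (fun hya => ?_) (fun hya => ?_)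
    · refine ifEq_runs_le (T := T + (16 * n + 6)) hc.2.1.symm (by decide) hc.2.2 h3 ez ec ht
        (by omega) (fun hzc => ?_) (fun hzc => ?_)
      · exact (hp (by simp [isOn, Fin.ext hxb, Fin.ext hya, Fin.ext hzc])).mono (by omega)
      · exact hr (Fin.ext hxb) fun h => hzc (congrArg Fin.val h.2)
    · exact (hr (Fin.ext hxb) fun h => hya (congrArg Fin.val h.1)).mono (by omega)
  · have hxb' : d.mid ≠ u := fun h => hxb (congrArg Fin.val h)
    exact (hq (by simp [isOn, hxb'])).mono (by omega)

/-- A truth value on a stack. -/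
def flag (b : Bool) : List InstanceSymbol := if b then [one] else []

/-- The test whether a stack is empty. -/
def emptyTest : Option InstanceSymbol → Option InstanceSymbol → Bool := fun x _ => x.isNone

/-- Sets a truth value to true. -/
def setFlag (f : KStack) : KProg := ite f f emptyTest (push f one) skip

theorem setFlag_runs (f : KStack) (b : Bool) (s : KState) (hs : s f = flag b) :
    Runs (setFlag f) s (update s f (flag true)) 2 := by
  cases b
  · refine (Runs.ite_true (by simp [hs, emptyTest, flag]) (Runs.push f one s)).of_eq ?_ le_rfl
    simp [hs, flag]
  · refine (Runs.ite_false (by simp [hs, emptyTest, flag]) (Runs.skip s)).of_eq ?_ le_rfl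
    rw [← hs, update_eq_self]

/-- Moves `lst` to `lst'` and notes which mates of the constraint on `ra`, `rb` and `rc` occur. -/
def findMates : KProg :=
  loop .lst .lst nonemptyTest
    (seq (popTriple .lst .rx .ry .rz)
    (seq (isOnTest .rb .ra .rc (setFlag .f₁) skip)
    (seq (isOnTest .rc .ra .rb (setFlag .f₂) skip)
      (pushTriple .rx .ry .rz .lst'))))

/-- The stacks while a constraint is inserted. -/
def insertState {n : ℕ} (I B : List InstanceSymbol) (c : BetweennessConstraint n)
    (L L' : List (BetweennessConstraint n)) (b₁ b₂ : Bool) : KState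
  | .inp => I
  | .bits => B
  | .ra => ones c.mid
  | .rb => ones c.left
  | .rc => ones c.right
  | .lst => encCs L
  | .lst' => encCs L'
  | .f₁ => flag b₁
  | .f₂ => flag b₂
  | _ => []

theorem findMates_runs {n : ℕ} (I B : List InstanceSymbol) (c : BetweennessConstraint n)
    (L L' : List (BetweennessConstraint n)) (b₁ b₂ : Bool) :
    Runs findMates (insertState I B c L L' b₁ b₂)
      (insertState I B c [] (L.reverse ++ L') (b₁ || L.any c.isLeftMate)
        (b₂ || L.any c.isRightMate)) (L.length * (100 * (n + 1)) + 1) := by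
  induction L generalizing L' b₁ b₂ with
  | nil => exact (Runs.loop_false rfl).of_eq (by simp) (by simp)
  | cons d L ih =>
    have h1 := d.mid.isLt.le
    have h2 := d.left.isLt.le
    have h3 := d.right.isLt.le
    set s := insertState I B c (d :: L) L' b₁ b₂ with hs
    set s₁ : KState := update (update (update (update s .lst (encCs L)) .rx (ones d.mid))
      .ry (ones d.left)) .rz (ones d.right) with hs₁
    have r1 : Runs (popTriple .lst .rx .ry .rz) s s₁ (9 * n + 6) :=
      popTriple_runs (by decide) (by decide) (by decide) (by decide) (by decide) (by decide)
        h1 h2 h3 _ s (encCs_cons d L) rfl rfl rfl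
    set s₂ : KState := update s₁ .f₁ (flag (b₁ || c.isLeftMate d)) with hs₂
    have r2 : Runs (isOnTest .rb .ra .rc (setFlag .f₁) skip) s₁ s₂ (2 + (40 * n + 15)) := by
      refine isOnTest_runs (by decide) (by decide) (by decide) (u := c.left) (v := c.mid)
        (w := c.right) d rfl rfl rfl rfl rfl rfl rfl (fun h => ?_) (fun h => ?_)
      · refine (setFlag_runs .f₁ b₁ s₁ rfl).of_eq ?_ le_rfl
        simp [hs₂, isLeftMate, h]
      · refine (Runs.skip s₁).of_eq ?_ (by omega)
        simp only [hs₂, isLeftMate, h, Bool.or_false]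
        exact (update_eq_self (f := s₁) KStack.f₁).symm
    set s₃ : KState := update s₂ .f₂ (flag (b₂ || c.isRightMate d)) with hs₃
    have r3 : Runs (isOnTest .rc .ra .rb (setFlag .f₂) skip) s₂ s₃ (2 + (40 * n + 15)) := by
      refine isOnTest_runs (by decide) (by decide) (by decide) (u := c.right) (v := c.mid)
        (w := c.left) d rfl rfl rfl rfl rfl rfl rfl (fun h => ?_) (fun h => ?_)
      · refine (setFlag_runs .f₂ b₂ s₂ rfl).of_eq ?_ le_rfl
        simp [hs₃, isRightMate, h]
      · refine (Runs.skip s₂).of_eq ?_ (by omega)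
        simp only [hs₃, isRightMate, h, Bool.or_false]
        exact (update_eq_self (f := s₂) KStack.f₂).symm
    have r4 : Runs (pushTriple .rx .ry .rz .lst') s₃ (insertState I B c L (d :: L')
        (b₁ || c.isLeftMate d) (b₂ || c.isRightMate d)) (9 * n + 6) := by
      refine (pushTriple_runs (by decide) (by decide) (by decide) (by decide) (by decide)
        (by decide) h1 h2 h3 s₃ rfl rfl rfl).of_eq ?_ le_rfl
      funext k
      cases k <;> first | rfl | exact (encCs_cons d L').symm
    refine (Runs.loop_true ?_ (r1.seq (r2.seq (r3.seq r4))) (ih _ _ _)).of_eq ?_ ?_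
    · change nonemptyTest (encCs (d :: L)).head? _ = true
      rw [encCs_cons]
      exact isSome_head?_unary_append _ _
    · simp [Bool.or_assoc]
    · simp only [List.length_cons]
      ring_nf
      omega

/-- Forgets the constraint on `rx`, `ry` and `rz`. -/
def dropTriple : KProg := seq (clear .rx) (seq (clear .ry) (clear .rz))

/-- Deals with the constraint on `rx`, `ry` and `rz` in `eraseMates`. -/
def eraseMatesStep : KProg :=
  let keep := pushTriple .rx .ry .rz .lst
  let rest := ite .f₂ .f₂ nonemptyTest
    (isOnTest .rc .ra .rb (seq (pop .f₂) dropTriple) keep) keep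
  ite .f₁ .f₁ nonemptyTest (isOnTest .rb .ra .rc (seq (pop .f₁) dropTriple) rest) rest

/-- Moves `lst'` back to `lst`, leaving out mates as long as the truth values ask for it. -/
def eraseMates : KProg :=
  loop .lst' .lst' nonemptyTest (seq (popTriple .lst' .rx .ry .rz) eraseMatesStep)

theorem dropTriple_runs {N a b c : ℕ} (ha : a ≤ N) (hb : b ≤ N) (hc : c ≤ N) (s : KState)
    (ex : s .rx = ones a) (ey : s .ry = ones b) (ez : s .rz = ones c) :
    Runs dropTriple s (update (update (update s .rx []) .ry []) .rz []) (6 * N + 3) := by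
  refine ((clear_runs _ s).seq ((clear_runs _ _).seq (clear_runs _ _))).mono ?_
  simp [ex, ey, ez, length_ones]
  omega

/-- The flags play the role of the Boolean arguments of `eraseTwo`. Their final values are left
unspecified, as `insertStep` clears them afterwards. -/
theorem eraseMates_runs {n : ℕ} (I B : List InstanceSymbol) (c : BetweennessConstraint n)
    (L L' : List (BetweennessConstraint n)) (b₁ b₂ : Bool) :
    ∃ b₁' b₂', Runs eraseMates (insertState I B c L L' b₁ b₂)
      (insertState I B c (eraseTwo c.isLeftMate c.isRightMate b₁ b₂ L' L) [] b₁' b₂')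
      (L'.length * (100 * (n + 1)) + 1) := by
  induction L' generalizing L b₁ b₂ with
  | nil => exact ⟨b₁, b₂, (Runs.loop_false rfl).of_eq (by simp [eraseTwo]) (by simp)⟩
  | cons d L' ih =>
    have h1 := d.mid.isLt.le
    have h2 := d.left.isLt.le
    have h3 := d.right.isLt.le
    set s := insertState I B c L (d :: L') b₁ b₂ with hs
    set s₁ : KState := update (update (update (update s .lst' (encCs L')) .rx (ones d.mid))
      .ry (ones d.left)) .rz (ones d.right) with hs₁
    have r1 : Runs (popTriple .lst' .rx .ry .rz) s s₁ (9 * n + 6) :=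
      popTriple_runs (by decide) (by decide) (by decide) (by decide) (by decide) (by decide)
        h1 h2 h3 _ s (encCs_cons d L') rfl rfl rfl
    have hkeep : Runs (pushTriple .rx .ry .rz .lst) s₁ (insertState I B c (d :: L) L' b₁ b₂)
        (9 * n + 6) := by
      refine (pushTriple_runs (by decide) (by decide) (by decide) (by decide) (by decide)
        (by decide) h1 h2 h3 s₁ rfl rfl rfl).of_eq ?_ le_rfl
      funext k
      cases k <;> first | rfl | exact (encCs_cons d L).symm
    obtain ⟨L₁, c₁, c₂, hL₁, r2⟩ : ∃ L₁ c₁ c₂,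
        eraseTwo c.isLeftMate c.isRightMate b₁ b₂ (d :: L') L =
          eraseTwo c.isLeftMate c.isRightMate c₁ c₂ L' L₁ ∧
        Runs eraseMatesStep s₁ (insertState I B c L₁ L' c₁ c₂) (89 * n + 38) := by
      have hdrop : ∀ f : KStack, f = .f₁ ∨ f = .f₂ →
          Runs (seq (pop f) dropTriple) s₁ (update (update (update (update s₁ f (s₁ f).tail)
            .rx []) .ry []) .rz []) (6 * n + 4) := by
        rintro f (rfl | rfl)
        · exact ((Runs.pop _ s₁).seq (dropTriple_runs h1 h2 h3 _ rfl rfl rfl)).mono (by omega)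
        · exact ((Runs.pop _ s₁).seq (dropTriple_runs h1 h2 h3 _ rfl rfl rfl)).mono (by omega)
      have hrest : ∃ L₁ c₂, eraseTwo c.isLeftMate c.isRightMate b₁ c₂ L' L₁ =
            (if b₂ && c.isRightMate d then eraseTwo c.isLeftMate c.isRightMate b₁ false L' L
            else eraseTwo c.isLeftMate c.isRightMate b₁ b₂ L' (d :: L)) ∧
          Runs (ite .f₂ .f₂ nonemptyTest (isOnTest .rc .ra .rb (seq (pop .f₂) dropTriple)
            (pushTriple .rx .ry .rz .lst)) (pushTriple .rx .ry .rz .lst)) s₁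
            (insertState I B c L₁ L' b₁ c₂) (49 * n + 22) := by
        cases b₂
        · exact ⟨d :: L, false, by simp, (Runs.ite_false rfl hkeep).mono (by omega)⟩
        · by_cases hd : c.isRightMate d = true
          · refine ⟨L, false, by simp [hd], (Runs.ite_true rfl (isOnTest_runs (T := 9 * n + 6)
              (by decide) (by decide) (by decide) (u := c.right) (v := c.mid) (w := c.left) d rfl
              rfl rfl rfl rfl rfl rfl (fun _ => ?_) fun h => absurd hd (by simp [isRightMate, h])
              )).mono (by omega)⟩
            refine (hdrop .f₂ (Or.inr rfl)).of_eq ?_ (by omega)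
            funext k
            cases k <;> rfl
          · refine ⟨d :: L, true, by simp [hd], (Runs.ite_true rfl (isOnTest_runs (T := 9 * n + 6)
              (by decide) (by decide) (by decide) (u := c.right) (v := c.mid) (w := c.left) d rfl
              rfl rfl rfl rfl rfl rfl (fun h => absurd h hd) fun h => hkeep)).mono (by omega)⟩
      obtain ⟨L₁, c₂, e, hrest⟩ := hrest
      cases b₁
      · exact ⟨L₁, false, c₂, by simp [eraseTwo, e], (Runs.ite_false rfl hrest).mono (by omega)⟩
      · by_cases hd : c.isLeftMate d = true
        · refine ⟨L, false, b₂, by simp [eraseTwo, hd], (Runs.ite_true rfl (isOnTest_runs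
            (T := 49 * n + 22) (by decide) (by decide) (by decide) (u := c.left) (v := c.mid)
            (w := c.right) d rfl rfl rfl rfl rfl rfl rfl (fun _ => ?_)
            fun h => absurd hd (by simp [isLeftMate, h]))).mono (by omega)⟩
          refine (hdrop .f₁ (Or.inl rfl)).of_eq ?_ (by omega)
          funext k
          cases k <;> rfl
        · exact ⟨L₁, true, c₂, by simp [eraseTwo, hd, e], (Runs.ite_true rfl (isOnTest_runs
            (T := 49 * n + 22) (by decide) (by decide) (by decide) (u := c.left) (v := c.mid)
            (w := c.right) d rfl rfl rfl rfl rfl rfl rfl (fun h => absurd h hd)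
            fun h => hrest)).mono (by omega)⟩
    obtain ⟨b₁', b₂', hr⟩ := ih L₁ c₁ c₂
    refine ⟨b₁', b₂', (Runs.loop_true ?_ (r1.seq r2) hr).of_eq (by rw [hL₁]) ?_⟩
    · change nonemptyTest (encCs (d :: L')).head? _ = true
      rw [encCs_cons]
      exact isSome_head?_unary_append _ _
    · simp only [List.length_cons]
      ring_nf
      omega

/-- Reads a constraint from the input and inserts it into `lst`. -/
def insertStep : KProg :=
  seq (popTriple .inp .ra .rb .rc)
  (seq findMates
  (seq (ite .f₁ .f₂ bothTest
    (seq eraseMates (seq (clear .ra) (seq (clear .rb) (clear .rc))))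
    (seq (clear .f₁) (seq (clear .f₂) (seq eraseMates (pushTriple .ra .rb .rc .lst)))))
  (seq (clear .f₁) (clear .f₂))))

/-- The stacks between the phases that handle the constraints. -/
def listState (I B L L' : List InstanceSymbol) : KState
  | .inp => I
  | .bits => B
  | .lst => L
  | .lst' => L'
  | _ => []

theorem length_flag_le (b : Bool) : (flag b).length ≤ 1 := by
  cases b <;> simp [flag]

theorem insertStep_runs {n : ℕ} (I B : List InstanceSymbol) (c : BetweennessConstraint n)
    (L : List (BetweennessConstraint n)) :
    Runs insertStep (listState (unary c.mid ++ (unary c.left ++ (unary c.right ++ I))) B (encCs L) [])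
      (listState I B (encCs (insertCancel L c)) []) ((L.length + 1) * (200 * (n + 1))) := by
  have h1 := c.mid.isLt.le
  have h2 := c.left.isLt.le
  have h3 := c.right.isLt.le
  have r1 : Runs (popTriple .inp .ra .rb .rc)
      (listState (unary c.mid ++ (unary c.left ++ (unary c.right ++ I))) B (encCs L) [])
      (insertState I B c L [] false false) (9 * n + 6) := by
    refine (popTriple_runs (by decide) (by decide) (by decide) (by decide) (by decide) (by decide)
        h1 h2 h3 I _ rfl rfl rfl rfl).of_eq ?_ le_rfl
    funext k
    cases k <;> rfl
  have r2 := findMates_runs I B c L [] false false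
  rw [List.append_nil, Bool.false_or, Bool.false_or] at r2
  have r3 : ∃ b₁ b₂, Runs (ite .f₁ .f₂ bothTest
      (seq eraseMates (seq (clear .ra) (seq (clear .rb) (clear .rc))))
      (seq (clear .f₁) (seq (clear .f₂) (seq eraseMates (pushTriple .ra .rb .rc .lst)))))
      (insertState I B c [] L.reverse (L.any c.isLeftMate) (L.any c.isRightMate))
      (update (update (listState I B (encCs (insertCancel L c)) []) .f₁ (flag b₁)) .f₂ (flag b₂))
      (L.length * (100 * (n + 1)) + (9 * n + 14)) := by
    by_cases hb : (L.any c.isLeftMate && L.any c.isRightMate) = true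
    · obtain ⟨b₁, b₂, r⟩ := eraseMates_runs I B c [] L.reverse (L.any c.isLeftMate)
        (L.any c.isRightMate)
      refine ⟨b₁, b₂, (Runs.ite_true ?_ (r.seq ((clear_runs _ _).seq ((clear_runs _ _).seq
        (clear_runs _ _))))).of_eq ?_ ?_⟩
      · rw [Bool.and_eq_true] at hb
        rw [hb.1, hb.2]
        rfl
      · have hins : insertCancel L c =
            eraseTwo c.isLeftMate c.isRightMate true true L.reverse [] := if_pos hb
        rw [Bool.and_eq_true] at hb
        rw [hins, hb.1, hb.2]
        funext k
        cases k <;> rfl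
      · have e1 : (ones c.mid).length ≤ n := by rwa [length_ones]
        have e2 : (ones c.left).length ≤ n := by rwa [length_ones]
        have e3 : (ones c.right).length ≤ n := by rwa [length_ones]
        simp only [List.length_reverse]
        simp [insertState, length_ones]
        omega
    -- With both flags cleared, `eraseMates` deletes nothing and only returns the constraints to
    -- `lst` in their old order.
    · have e : update (update (insertState I B c [] L.reverse (L.any c.isLeftMate)
          (L.any c.isRightMate)) .f₁ []) .f₂ [] = insertState I B c [] L.reverse false false := by
        funext k
        cases k <;> rfl
      obtain ⟨b₁, b₂, r⟩ := eraseMates_runs I B c [] L.reverse false false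
      refine ⟨b₁, b₂, (Runs.ite_false ?_ ((clear_runs _ _).seq ((clear_runs _ _).seq
        (Runs.seq (e ▸ r) (pushTriple_runs (by decide) (by decide) (by decide) (by decide)
          (by decide) (by decide) h1 h2 h3 _ rfl rfl rfl))))).of_eq ?_ ?_⟩
      · change bothTest (flag (L.any c.isLeftMate)).head? (flag (L.any c.isRightMate)).head? = false
        revert hb
        cases L.any c.isLeftMate <;> cases L.any c.isRightMate <;> decide
      · have hins : insertCancel L c = c :: L := if_neg hb
        rw [hins, eraseTwo_false_false, List.reverse_reverse, List.append_nil]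
        funext k
        cases k <;> first | rfl | exact (encCs_cons c L).symm
      · have e1 := length_flag_le (L.any c.isLeftMate)
        have e2 := length_flag_le (L.any c.isRightMate)
        rw [List.length_reverse]
        change 2 * (flag (L.any c.isLeftMate)).length + 1 +
          (2 * (flag (L.any c.isRightMate)).length + 1 +
            (L.length * (100 * (n + 1)) + 1 + (9 * n + 6))) + 1 ≤ _
        omega
  obtain ⟨b₁, b₂, r3⟩ := r3
  have r4 : Runs (seq (clear .f₁) (clear .f₂))
      (update (update (listState I B (encCs (insertCancel L c)) []) .f₁ (flag b₁)) .f₂ (flag b₂))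
      (listState I B (encCs (insertCancel L c)) []) 6 := by
    refine ((clear_runs _ _).seq (clear_runs _ _)).of_eq ?_ ?_
    · funext k
      cases k <;> rfl
    · have e1 := length_flag_le b₁
      have e2 := length_flag_le b₂
      change 2 * (flag b₁).length + 1 + (2 * (flag b₂).length + 1) ≤ 6
      omega
  refine (r1.seq (r2.seq (r3.seq r4))).mono ?_
  ring_nf
  omega

/-- Reads all constraints and cancels them. -/
def insertAll : KProg := loop .inp .inp nonemptyTest insertStep

theorem length_insertCancel_le {n : ℕ} (L : List (BetweennessConstraint n))
    (c : BetweennessConstraint n) : (insertCancel L c).length ≤ L.length + 1 := by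
  obtain ⟨k, h, -⟩ := insertCancel_count L c
  omega

/-- An insertion lengthens the stored list by at most 1, so `M` bounds its length throughout and
makes the cost of a step uniform. -/
theorem insertAll_runs {n : ℕ} (B : List InstanceSymbol) (Cs L : List (BetweennessConstraint n))
    (M : ℕ) (hM : L.length + Cs.length ≤ M) :
    Runs insertAll (listState (encCs Cs) B (encCs L) [])
      (listState [] B (encCs (Cs.foldl insertCancel L)) [])
      (Cs.length * ((M + 1) * (200 * (n + 1)) + 1) + 1) := by
  induction Cs generalizing L with
  | nil => exact (Runs.loop_false rfl).of_eq (by simp [encCs]) (by simp)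
  | cons c Cs ih =>
    have hlen := length_insertCancel_le L c
    simp only [List.length_cons] at hM
    refine (Runs.loop_true ?_ (by rw [encCs_cons]; exact insertStep_runs _ B c L)
      (ih _ (by omega))).of_eq rfl ?_
    · change nonemptyTest (encCs (c :: Cs)).head? _ = true
      rw [encCs_cons]
      exact isSome_head?_unary_append _ _
    · have : (L.length + 1) * (200 * (n + 1)) ≤ (M + 1) * (200 * (n + 1)) :=
        Nat.mul_le_mul_right _ (by omega)
      rw [List.length_cons, Nat.succ_mul Cs.length]
      omega

/-! ### Reading the parameter and comparing with the threshold. -/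

/-- The test whether the top symbol is a binary digit. -/
def digitTest : Option InstanceSymbol → Option InstanceSymbol → Bool :=
  fun x _ => decide (x = some one) || decide (x = some zero)

/-- Moves binary digits from one stack to another one. -/
def moveBits (a b : KStack) : KProg :=
  loop a a digitTest (ite a a oneTest (seq (pop a) (push b one)) (seq (pop a) (push b zero)))

theorem moveBits_runs {a b : KStack} (hab : a ≠ b) (l : List Bool) (r : List InstanceSymbol)
    (hr : r = [] ∨ r.head? = some sep) (s : KState) (hs : s a = l.map ofBool ++ r) :
    Runs (moveBits a b) s (update (update s a r) b (l.reverse.map ofBool ++ s b))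
      (4 * l.length + 1) := by
  induction l generalizing s with
  | nil =>
    have hs' : s a = r := hs
    refine (Runs.loop_false ?_).of_eq ?_ (by simp)
    · rcases hr with hr | hr <;> simp [hs', digitTest, hr]
    · rw [← hs', update_eq_self]
      simp
  | cons x l ih =>
    cases x
    · refine (Runs.loop_true (by simp [hs, digitTest, ofBool])
        (Runs.ite_false (by simp [hs, oneTest, ofBool])
          ((Runs.pop a s).seq (Runs.push b zero _))) (ih _ ?_)).of_eq ?_ ?_
      · simp [hab, hs]
      · simp [hab.symm, ofBool, update_comm hab]
      · simp only [List.length_cons]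
        omega
    · refine (Runs.loop_true (by simp [hs, digitTest, ofBool])
        (Runs.ite_true (by simp [hs, oneTest, ofBool])
          ((Runs.pop a s).seq (Runs.push b one _))) (ih _ ?_)).of_eq ?_ ?_
      · simp [hab, hs]
      · simp [hab.symm, ofBool, update_comm hab]
      · simp only [List.length_cons]
        omega

/-- Reads the parameter and skips the list of variables. -/
def readHeader : KProg :=
  seq (moveBits .inp .bits) (seq (pop .inp) (seq (popBlock .inp .rx) (clear .rx)))

/-- The input lists the least significant digit first; moving reverses this, as Horner evaluation
needs. -/
theorem readHeader_runs (l : List Bool) (n : ℕ) (I : List InstanceSymbol) :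
    Runs readHeader (listState (l.map ofBool ++ (sep :: (unary n ++ I))) [] [] [])
      (listState I (l.reverse.map ofBool) [] []) (4 * l.length + 5 * n + 5) := by
  refine ((moveBits_runs (by decide) l _ (Or.inr rfl) _ rfl).seq ((Runs.pop _ _).seq
    ((popBlock_runs (by decide) n I _ rfl rfl).seq (clear_runs _ _)))).of_eq ?_ ?_
  · funext k
    cases k <;> first | rfl | exact List.append_nil _
  · change 4 * l.length + 1 + (1 + (3 * n + 2 + (2 * (ones n).length + 1))) ≤ _
    rw [length_ones]
    omega

/-- The stacks while the threshold is computed. -/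
def arithState (B B' L L' : List InstanceSymbol) (m v x p : ℕ) : KState
  | .bits => B
  | .bits' => B'
  | .lst => L
  | .lst' => L'
  | .cnt => ones m
  | .val => ones v
  | .rx => ones x
  | .prod => ones p
  | _ => []

/-- Reverses the numbers of `lst` onto `lst'` and counts them. -/
def countNums : KProg :=
  loop .lst .lst nonemptyTest (seq (popBlock .lst .rx) (seq (pushBlock .rx .lst') (push .cnt one)))

theorem countNums_runs (B : List InstanceSymbol) (N : ℕ) (l l' : List ℕ) (m : ℕ)
    (hl : ∀ a ∈ l, a ≤ N) :
    Runs countNums (arithState B [] (encNums l) (encNums l') m 0 0 0)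
      (arithState B [] [] (encNums (l.reverse ++ l')) (m + l.length) 0 0 0)
      (l.length * (6 * (N + 1)) + 1) := by
  induction l generalizing l' m with
  | nil => exact (Runs.loop_false rfl).of_eq (by simp [encNums]) (by simp)
  | cons a l ih =>
    have ha := hl a (by simp)
    have r : Runs (seq (popBlock .lst .rx) (seq (pushBlock .rx .lst') (push .cnt one)))
        (arithState B [] (encNums (a :: l)) (encNums l') m 0 0 0)
        (arithState B [] (encNums l) (encNums (a :: l')) (m + 1) 0 0 0) (6 * a + 5) := by
      refine ((popBlock_runs (by decide) a (encNums l) _ (encNums_cons a l) rfl).seq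
        ((pushBlock_runs (by decide) a _ rfl).seq (Runs.push _ _ _))).of_eq ?_ (by omega)
      funext k
      cases k <;> rfl
    refine (Runs.loop_true ?_ r (ih (a :: l') (m + 1) fun b hb => hl b (by simp [hb]))).of_eq ?_ ?_
    · change nonemptyTest (encNums (a :: l)).head? _ = true
      rw [encNums_cons]
      exact isSome_head?_unary_append _ _
    · simp only [List.reverse_cons, List.append_assoc, List.singleton_append, List.length_cons]
      congr 1
      omega
    · rw [List.length_cons, Nat.succ_mul l.length]
      omega

/-- Doubles the number on `val`, as strokes on `val'`. -/
def doubleVal : KProg :=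
  loop .val .val nonemptyTest (seq (pop .val) (seq (push .val' one) (push .val' one)))

theorem doubleVal_runs (v : ℕ) (s : KState) (hs : s .val = ones v) :
    Runs doubleVal s (update (update s .val []) .val' (ones (2 * v) ++ s .val')) (4 * v + 1) := by
  induction v generalizing s with
  | zero =>
    have hs' : s .val = [] := hs
    refine (Runs.loop_false (by simp [hs', nonemptyTest])).of_eq ?_ (by simp)
    rw [← hs', update_eq_self]
    simp [ones]
  | succ v ih =>
    refine (Runs.loop_true (by simp [hs, nonemptyTest, ones_succ])
      ((Runs.pop KStack.val s).seq ((Runs.push KStack.val' one _).seq (Runs.push KStack.val' one _)))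
      (ih _ (by simp [hs, ones_succ]))).of_eq ?_ (by omega)
    funext k
    have e : 2 * (v + 1) = 2 * v + 1 + 1 := by omega
    simp only [update_apply]
    split_ifs <;> simp_all [ones_succ, ones_append_cons]

/-- Replaces the number on `val` by one more than the number on `cnt` if it is larger. -/
def capVal : KProg :=
  seq (cancelOnes .val .cnt) (seq (ite .val .val nonemptyTest (seq (clear .val) (push .val one)) skip)
    (restore .val .cnt))

theorem capVal_runs (B B' L L' : List InstanceSymbol) (m v x p : ℕ) :
    Runs capVal (arithState B B' L L' m v x p) (arithState B B' L L' m (min v (m + 1)) x p)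
      (10 * (v + m + 1)) := by
  rcases le_or_gt v m with h | h
  · obtain ⟨d, rfl⟩ := Nat.exists_eq_add_of_le h
    have r1 := cancelOnes_runs (x := .val) (y := .cnt) (by decide) (by decide) (by decide) v 0 d
      (Or.inl rfl) (arithState B B' L L' (v + d) v x p) rfl rfl
    have r3 := restore_runs (x := .val) (y := .cnt) (by decide) (by decide) (by decide) v
      (update (update (update (arithState B B' L L' (v + d) v x p) .tmp
        (ones v ++ [])) .val (ones 0)) .cnt (ones d)) (List.append_nil _)
    refine (r1.seq ((Runs.ite_false rfl (Runs.skip _)).seq r3)).of_eq ?_ (by omega)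
    rw [Nat.min_eq_left (by omega)]
    funext k
    cases k <;> first | rfl | exact List.append_nil _ | exact List.replicate_append_replicate
  -- The nonempty remainder shrinks to one stroke; with the `m` cancelled strokes put back, `val` is
  -- `m + 1`.
  · obtain ⟨d, rfl⟩ := Nat.exists_eq_add_of_lt h
    have r1 := cancelOnes_runs (x := .val) (y := .cnt) (by decide) (by decide) (by decide) m (d + 1) 0
      (Or.inr rfl) (arithState B B' L L' m (m + d + 1) x p) rfl rfl
    have r2 : Runs (ite .val .val nonemptyTest (seq (clear .val) (push .val one)) skip)
        (update (update (update (arithState B B' L L' m (m + d + 1) x p) .tmp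
          (ones m ++ [])) .val (ones (d + 1))) .cnt (ones 0))
        (update (update (update (arithState B B' L L' m (m + d + 1) x p) .tmp
          (ones m ++ [])) .val (ones 1)) .cnt (ones 0)) (2 * (d + 1) + 3) := by
      refine (Runs.ite_true rfl ((clear_runs _ _).seq (Runs.push _ _ _))).of_eq ?_ ?_
      · funext k
        cases k <;> rfl
      · change 2 * (ones (d + 1)).length + 1 + 1 + 1 ≤ _
        rw [length_ones]
    have r3 := restore_runs (x := .val) (y := .cnt) (by decide) (by decide) (by decide) m
      (update (update (update (arithState B B' L L' m (m + d + 1) x p) .tmp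
        (ones m ++ [])) .val (ones 1)) .cnt (ones 0)) (List.append_nil _)
    refine (r1.seq (r2.seq r3)).of_eq ?_ (by omega)
    rw [Nat.min_eq_right (by omega)]
    funext k
    cases k <;> first | rfl | exact List.append_nil _ | exact List.replicate_append_replicate

/-- Appends a binary digit to the number on `val`, up to saturation. -/
def appendDigit (b : Bool) : KProg :=
  seq doubleVal (seq (if b then push .val' one else skip) (seq (moveOnes .val' .val) capVal))

theorem appendDigit_runs (b : Bool) (B B' L L' : List InstanceSymbol) (m v x p : ℕ)
    (hv : v ≤ m + 1) :
    Runs (appendDigit b) (arithState B B' L L' m v x p)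
      (arithState B B' L L' m (min (2 * v + b.toNat) (m + 1)) x p) (80 * (m + 1)) := by
  have r1 := doubleVal_runs v (arithState B B' L L' m v x p) rfl
  have r2 : Runs (if b then push .val' one else skip : KProg)
      (update (update (arithState B B' L L' m v x p) .val []) .val' (ones (2 * v) ++ []))
      (update (update (arithState B B' L L' m v x p) .val []) .val' (ones (2 * v + b.toNat))) 1 := by
    cases b
    · exact (Runs.skip _).of_eq (by simp) le_rfl
    · refine (Runs.push _ _ _).of_eq ?_ le_rfl
      funext k
      cases k <;> first | rfl | exact congrArg (one :: ·) (List.append_nil _)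
  have r3 : Runs (moveOnes .val' .val)
      (update (update (arithState B B' L L' m v x p) .val []) .val' (ones (2 * v + b.toNat)))
      (arithState B B' L L' m (2 * v + b.toNat) x p) (3 * (2 * v + b.toNat) + 1) := by
    refine (moveOnes_runs (by decide) (2 * v + b.toNat) [] (by simp) _
      (List.append_nil _).symm).of_eq ?_ le_rfl
    funext k
    cases k <;> first | rfl | exact List.append_nil _
  have hb := Bool.toNat_le b
  exact (r1.seq (r2.seq (r3.seq (capVal_runs B B' L L' m _ x p)))).mono (by omega)

/-- Computes the number with the binary digits on `bits`, up to saturation. -/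
def evalBits : KProg :=
  loop .bits .bits nonemptyTest (ite .bits .bits oneTest
    (seq (pop .bits) (seq (push .bits' one) (appendDigit true)))
    (seq (pop .bits) (seq (push .bits' zero) (appendDigit false))))

/-- Horner's scheme with truncation at `m + 1` after each digit, which keeps the unary value short.
The digits are saved on `bits'`, since the output may need them. -/
theorem evalBits_runs (l l' : List Bool) (L L' : List InstanceSymbol) (m v x p : ℕ)
    (hv : v ≤ m + 1) :
    Runs evalBits (arithState (l.map ofBool) (l'.map ofBool) L L' m v x p)
      (arithState [] ((l.reverse ++ l').map ofBool) L L' m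
        (l.foldl (fun v b => min (2 * v + b.toNat) (m + 1)) v) x p)
      (l.length * (90 * (m + 1)) + 1) := by
  induction l generalizing l' v with
  | nil => exact (Runs.loop_false rfl).of_eq (by simp) (by simp)
  | cons b l ih =>
    have hih := ih (b :: l') (min (2 * v + b.toNat) (m + 1)) (by omega)
    have h1 : Runs (ite .bits .bits oneTest
        (seq (pop .bits) (seq (push .bits' one) (appendDigit true)))
        (seq (pop .bits) (seq (push .bits' zero) (appendDigit false))) : KProg)
        (arithState ((b :: l).map ofBool) (l'.map ofBool) L L' m v x p)
        (arithState (l.map ofBool) ((b :: l').map ofBool) L L' m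
          (min (2 * v + b.toNat) (m + 1)) x p) (80 * (m + 1) + 3) := by
      have r := appendDigit_runs b (l.map ofBool) ((b :: l').map ofBool) L L' m v x p hv
      have e : ∀ y, y = ofBool b →
          update (update (arithState ((b :: l).map ofBool) (l'.map ofBool) L L' m v x p) .bits
          (l.map ofBool)) .bits' (y :: l'.map ofBool) =
          arithState (l.map ofBool) ((b :: l').map ofBool) L L' m v x p := by
        rintro _ rfl
        funext k
        cases k <;> rfl
      cases b
      · exact (Runs.ite_false rfl ((Runs.pop _ _).seq (((Runs.push _ _ _).of_eq (e zero rfl)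
          le_rfl).seq r))).mono (by omega)
      · exact (Runs.ite_true rfl ((Runs.pop _ _).seq (((Runs.push _ _ _).of_eq (e one rfl)
          le_rfl).seq r))).mono (by omega)
    refine (Runs.loop_true rfl h1 hih).of_eq (by simp) ?_
    simp only [List.length_cons]
    ring_nf
    omega

theorem rep_appendDigit_runs (k : ℕ) (B B' L L' : List InstanceSymbol) (m v x p : ℕ) :
    Runs (rep (appendDigit false) k) (arithState B B' L L' m (min v (m + 1)) x p)
      (arithState B B' L L' m (min (2 ^ k * v) (m + 1)) x p) (k * (80 * (m + 1)) + 1) := by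
  induction k generalizing v with
  | zero => exact (Runs.skip _).of_eq (by simp) (by simp)
  | succ k ih =>
    have e : min (2 * min v (m + 1) + false.toNat) (m + 1) = min (2 * v) (m + 1) := by
      simp only [Bool.toNat_false]
      omega
    refine ((appendDigit_runs false B B' L L' m _ x p (by omega)).seq (e ▸ ih (2 * v))).of_eq ?_ ?_
    · rw [pow_succ, mul_assoc]
    · rw [Nat.succ_mul k]
      omega

/-- Adds the number on `val` to the number on another stack. -/
def addVal (x : KStack) : KProg :=
  seq (loop .val .val nonemptyTest (seq (pop .val) (seq (push .val' one) (push x one))))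
    (moveOnes .val' .val)

theorem addVal_runs {x : KStack} (hx : x ≠ .val) (hx' : x ≠ .val') (v : ℕ) (s : KState)
    (hs : s .val = ones v) (hs' : s .val' = []) :
    Runs (addVal x) s (update s x (ones v ++ s x)) (7 * v + 2) := by
  have h : ∀ (v : ℕ) (s : KState), s .val = ones v →
      Runs (loop .val .val nonemptyTest (seq (pop .val) (seq (push .val' one) (push x one)))) s
        (update (update (update s .val []) .val' (ones v ++ s .val')) x (ones v ++ s x))
        (4 * v + 1) := by
    intro v
    induction v with
    | zero =>
      intro s hs
      have hs' : s .val = [] := hs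
      refine (Runs.loop_false (by simp [hs', nonemptyTest])).of_eq ?_ (by simp)
      rw [← hs', update_eq_self]
      simp [ones]
    | succ v ih =>
      intro s hs
      refine (Runs.loop_true (by simp [hs, nonemptyTest, ones_succ])
        ((Runs.pop KStack.val s).seq ((Runs.push KStack.val' one _).seq (Runs.push x one _)))
        (ih _ (by simp [hs, hx.symm, ones_succ]))).of_eq ?_ (by omega)
      funext k
      simp only [update_apply]
      split_ifs <;> simp_all [ones_succ, ones_append_cons]
  refine ((h v s hs).seq (moveOnes_runs (by decide) v [] (by simp) _
    (by simp [hx'.symm, hs']))).of_eq ?_ (by omega)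
  funext k
  simp only [update_apply]
  split_ifs <;> simp_all

/-- Computes the square of the number on `val`. -/
def squareVal : KProg :=
  seq (addVal .rx) (loop .rx .rx nonemptyTest (seq (pop .rx) (addVal .prod)))

theorem squareVal_runs (B B' L L' : List InstanceSymbol) (m v : ℕ) :
    Runs squareVal (arithState B B' L L' m v 0 0) (arithState B B' L L' m v 0 (v * v))
      (10 * (v + 1) ^ 2) := by
  have h : ∀ x p, Runs (loop .rx .rx nonemptyTest (seq (pop .rx) (addVal .prod)))
      (arithState B B' L L' m v x p) (arithState B B' L L' m v 0 (p + x * v))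
      (x * (7 * v + 4) + 1) := by
    intro x
    induction x with
    | zero => exact fun p => (Runs.loop_false rfl).of_eq (by simp) (by simp)
    | succ x ih =>
      intro p
      have r := addVal_runs (x := .prod) (by decide) (by decide) v (arithState B B' L L' m v x p)
        rfl rfl
      have e : update (arithState B B' L L' m v x p) .prod (ones v ++ ones p) =
          arithState B B' L L' m v x (v + p) := by
        funext k
        cases k <;> first | rfl | exact List.replicate_append_replicate
      have e' : update (arithState B B' L L' m v (x + 1) p) .rx (ones x) =
          arithState B B' L L' m v x p := by
        funext k
        cases k <;> rfl
      refine (Runs.loop_true rfl (((Runs.pop _ _).of_eq e' le_rfl).seq (r.of_eq e le_rfl))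
        (ih _)).of_eq ?_ ?_
      · congr 1
        ring
      · rw [Nat.succ_mul x]
        omega
  have r := addVal_runs (x := .rx) (by decide) (by decide) v (arithState B B' L L' m v 0 0) rfl rfl
  have e : update (arithState B B' L L' m v 0 0) .rx (ones v ++ []) =
      arithState B B' L L' m v v 0 := by
    funext k
    cases k <;> first | rfl | exact List.append_nil _
  refine ((r.of_eq e le_rfl).seq (h v 0)).of_eq (by simp) ?_
  ring_nf
  omega

/-- Truncating at each step or once at the end is the same, because a value that has reached `C`
stays at least `C` under `2 * v + b`. -/
theorem foldl_saturate (C : ℕ) (l : List Bool) :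
    l.reverse.foldl (fun v b => min (2 * v + b.toNat) C) 0 =
      min (l.foldr (fun b v => 2 * v + b.toNat) 0) C := by
  rw [List.foldl_reverse]
  induction l with
  | nil => simp
  | cons b l ih =>
    simp only [List.foldr_cons, ih]
    omega

theorem foldr_encodeNat (k : ℕ) :
    (Computability.encodeNat k).foldr (fun b v => 2 * v + b.toNat) 0 = k := by
  have hpos : ∀ p : PosNum, (Computability.encodePosNum p).foldr
      (fun b v => 2 * v + b.toNat) 0 = (p : ℕ) := by
    intro p
    induction p with
    | one => rfl
    | bit0 p ih =>
      rw [Computability.encodePosNum, List.foldr_cons, ih, PosNum.cast_bit0]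
      simp
      omega
    | bit1 p ih =>
      rw [Computability.encodePosNum, List.foldr_cons, ih, PosNum.cast_bit1]
      simp
      omega
  have hnum : ∀ p : Num, (Computability.encodeNum p).foldr
      (fun b v => 2 * v + b.toNat) 0 = (p : ℕ) := by
    intro p
    cases p with
    | zero => rfl
    | pos p => exact hpos p
  exact (hnum _).trans (Num.to_of_nat k)

/-- Compares the square of `val` with `cnt`; `prod` is empty afterwards if it is not larger. -/
def compareSquare : KProg :=
  seq (cancelOnes .prod .cnt) (seq (clear .tmp) (seq (clear .cnt) (clear .val)))

/-- What is left on `prod` is the truncated difference, empty exactly when `p ≤ m`. -/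
theorem compareSquare_runs (B L' : List InstanceSymbol) (m v p : ℕ) :
    Runs compareSquare (arithState B [] [] L' m v 0 p) (arithState B [] [] L' 0 0 0 (p - m))
      (10 * (m + v + p + 1)) := by
  obtain ⟨n, a, b, hab, rfl, rfl⟩ : ∃ n a b, (a = 0 ∨ b = 0) ∧ p = n + a ∧ m = n + b :=
    ⟨min p m, p - min p m, m - min p m, by omega, by omega, by omega⟩
  have r := cancelOnes_runs (x := .prod) (y := .cnt) (by decide) (by decide) (by decide) n a b hab
    (arithState B [] [] L' (n + b) v 0 (n + a)) rfl rfl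
  refine (r.seq ((clear_runs _ _).seq ((clear_runs _ _).seq (clear_runs _ _)))).of_eq ?_ ?_
  · have e : n + a - (n + b) = a := by omega
    rw [e]
    funext k
    cases k <;> rfl
  · change 4 * n + 1 + (2 * (ones n ++ []).length + 1 + (2 * (ones b).length + 1 +
      (2 * (ones v).length + 1))) ≤ _
    rw [List.append_nil, length_ones, length_ones, length_ones]
    omega

/-! ### Renaming variables and writing the output. -/

/-- The stacks while the output is written. -/
def outState (B L' : List InstanceSymbol) (D D' : List ℕ) (x j : ℕ) (b : Bool)
    (O : List InstanceSymbol) : KState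
  | .bits => B
  | .lst' => L'
  | .dic => encNums D
  | .dic' => encNums D'
  | .rx => ones x
  | .rz => ones j
  | .f₁ => flag b
  | .out => O
  | _ => []

/-- Moves `dic` to `dic'` and counts the numbers before the first one that equals `rx`. -/
def findNum : KProg :=
  loop .dic .dic nonemptyTest
    (seq (popBlock .dic .ry)
    (seq (ite .f₁ .f₁ emptyTest (ifEq .rx .ry (push .f₁ one) (push .rz one)) skip)
      (pushBlock .ry .dic')))

theorem findNum_runs (B L' O : List InstanceSymbol) {N x : ℕ} (hx : x ≤ N) (D D' : List ℕ)
    (hD : ∀ a ∈ D, a ≤ N) (j : ℕ) (b : Bool) :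
    Runs findNum (outState B L' D D' x j b O)
      (outState B L' [] (D.reverse ++ D') x (if b then j else j + D.idxOf x)
        (b || decide (x ∈ D)) O) (D.length * (20 * (N + 1)) + 1) := by
  induction D generalizing D' j b with
  | nil => exact (Runs.loop_false rfl).of_eq (by cases b <;> simp) (by simp)
  | cons a D ih =>
    have ha := hD a (by simp)
    set s := outState B L' (a :: D) D' x j b O with hs
    have r1 : Runs (popBlock .dic .ry) s (update (update s .dic (encNums D)) .ry (ones a))
        (3 * a + 2) := popBlock_runs (by decide) a _ s (encNums_cons a D) rfl
    set s₁ := update (update s .dic (encNums D)) .ry (ones a) with hs₁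
    have r2 : Runs (ite .f₁ .f₁ emptyTest (ifEq .rx .ry (push .f₁ one) (push .rz one)) skip) s₁
        (update (update s₁ .rz (ones (if b || decide (x = a) then j else j + 1))) .f₁
          (flag (b || decide (x = a)))) (8 * x + 5) := by
      cases b
      · refine (Runs.ite_true rfl (ifEq_runs (T := 1) (by decide) (by decide) (by decide) x a rfl
          rfl rfl (fun h => ?_) fun h => ?_)).mono (by omega)
        · refine (Runs.push _ _ _).of_eq ?_ le_rfl
          simp only [h, decide_true, Bool.or_true, if_true]
          funext k
          cases k <;> rfl
        · refine (Runs.push _ _ _).of_eq ?_ le_rfl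
          simp only [h, decide_false, Bool.or_false, Bool.false_eq_true, if_false]
          funext k
          cases k <;> rfl
      · refine (Runs.ite_false rfl (Runs.skip _)).of_eq ?_ (by omega)
        simp only [Bool.true_or, if_true]
        funext k
        cases k <;> rfl
    have r3 : Runs (pushBlock .ry .dic')
        (update (update s₁ .rz (ones (if b || decide (x = a) then j else j + 1))) .f₁
          (flag (b || decide (x = a))))
        (outState B L' D (a :: D') x (if b || decide (x = a) then j else j + 1)
          (b || decide (x = a)) O) (3 * a + 2) := by
      refine (pushBlock_runs (by decide) a _ rfl).of_eq ?_ le_rfl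
      funext k
      cases k <;> rfl
    refine (Runs.loop_true ?_ (r1.seq (r2.seq r3)) (ih _ (fun c hc => hD c (by simp [hc])) _
      _)).of_eq ?_ ?_
    · change nonemptyTest (encNums (a :: D)).head? _ = true
      rw [encNums_cons]
      exact isSome_head?_unary_append _ _
    · congr 1
      · simp
      · by_cases h : x = a
        · simp [h]
        · cases b
          · have h' : (a == x) = false := by simpa using fun e => h e.symm
            simp [h, List.idxOf_cons, h']
            omega
          · simp
      · by_cases h : x = a <;> simp [h]
    · rw [List.length_cons, Nat.succ_mul D.length]
      omega

/-- Moves `dic'` back to `dic`. -/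
def restoreDic : KProg :=
  loop .dic' .dic' nonemptyTest (seq (popBlock .dic' .ry) (pushBlock .ry .dic))

theorem restoreDic_runs (B L' O : List InstanceSymbol) {N : ℕ} (D D' : List ℕ)
    (hD : ∀ a ∈ D', a ≤ N) (x j : ℕ) (b : Bool) :
    Runs restoreDic (outState B L' D D' x j b O) (outState B L' (D'.reverse ++ D) [] x j b O)
      (D'.length * (20 * (N + 1)) + 1) := by
  induction D' generalizing D with
  | nil => exact (Runs.loop_false rfl).of_eq (by simp) (by simp)
  | cons a D' ih =>
    have ha := hD a (by simp)
    have r : Runs (seq (popBlock .dic' .ry) (pushBlock .ry .dic))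
        (outState B L' D (a :: D') x j b O) (outState B L' (a :: D) D' x j b O) (6 * a + 4) := by
      refine ((popBlock_runs (by decide) a (encNums D') _ (encNums_cons a D') rfl).seq
        (pushBlock_runs (by decide) a _ rfl)).of_eq ?_ (by omega)
      funext k
      cases k <;> rfl
    refine (Runs.loop_true ?_ r (ih (a :: D) fun c hc => hD c (by simp [hc]))).of_eq ?_ ?_
    · change nonemptyTest (encNums (a :: D')).head? _ = true
      rw [encNums_cons]
      exact isSome_head?_unary_append _ _
    · simp
    · rw [List.length_cons, Nat.succ_mul D'.length]
      omega

/-- Replaces a variable by its place in the list of the variables seen so far. -/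
def renumberStep : KProg :=
  seq (popBlock .lst' .rx) (seq findNum
    (seq (ite .f₁ .f₁ emptyTest (pushBlock .rx .dic') (seq (pop .f₁) (clear .rx)))
      (seq restoreDic (pushBlock .rz .out))))

theorem length_appendNew_le {α : Type*} [DecidableEq α] (D : List α) (x : α) :
    (appendNew D x).length ≤ D.length + 1 := by
  unfold appendNew
  split_ifs <;> simp

theorem mem_appendNew {α : Type*} [DecidableEq α] (D : List α) (x a : α) :
    a ∈ appendNew D x ↔ a ∈ D ∨ a = x := by
  unfold appendNew
  split_ifs with h
  · exact ⟨Or.inl, fun h' => h'.elim id fun e => e ▸ h⟩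
  · simp

/-- After the search `dic'` holds the dictionary reversed, so a new variable pushed there ends up
last once the dictionary is restored. The count on `rz` is then `D.length`, its correct place. -/
theorem renumberStep_runs (B L' O : List InstanceSymbol) {N x : ℕ} (hx : x ≤ N) (D : List ℕ)
    (hD : ∀ a ∈ D, a ≤ N) :
    Runs renumberStep (outState B (unary x ++ L') D [] 0 0 false O)
      (outState B L' (appendNew D x) [] 0 0 false (unary (D.idxOf x) ++ O))
      ((D.length + 1) * (60 * (N + 1))) := by
  have r1 : Runs (popBlock .lst' .rx) (outState B (unary x ++ L') D [] 0 0 false O)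
      (outState B L' D [] x 0 false O) (3 * x + 2) := by
    refine (popBlock_runs (by decide) x L' _ rfl rfl).of_eq ?_ le_rfl
    funext k
    cases k <;> rfl
  have r2 := findNum_runs B L' O hx D [] hD 0 false
  simp only [List.append_nil, Bool.false_eq_true, if_false, zero_add, Bool.false_or] at r2
  have r3 : Runs (ite .f₁ .f₁ emptyTest (pushBlock .rx .dic') (seq (pop .f₁) (clear .rx)))
      (outState B L' [] D.reverse x (D.idxOf x) (decide (x ∈ D)) O)
      (outState B L' [] (appendNew D x).reverse 0 (D.idxOf x) false O) (3 * x + 3) := by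
    by_cases h : x ∈ D
    · simp only [h, decide_true, appendNew, if_true]
      refine (Runs.ite_false rfl ((Runs.pop _ _).seq (clear_runs _ _))).of_eq ?_ ?_
      · funext k
        cases k <;> rfl
      · change 1 + (2 * (ones x).length + 1) + 1 ≤ _
        rw [length_ones]
        omega
    · simp only [h, decide_false, appendNew, if_false, List.reverse_append, List.reverse_cons,
        List.reverse_nil, List.nil_append, List.singleton_append]
      refine (Runs.ite_true rfl (pushBlock_runs (by decide) x _ rfl)).of_eq ?_ (by omega)
      funext k
      cases k <;> rfl
  have r4 := restoreDic_runs B L' O (N := N) [] (appendNew D x).reverse (fun a ha => by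
    rw [List.mem_reverse, mem_appendNew] at ha
    exact ha.elim (hD a) fun e => e ▸ hx) 0 (D.idxOf x) false
  rw [List.reverse_reverse, List.append_nil, List.length_reverse] at r4
  have r5 : Runs (pushBlock .rz .out) (outState B L' (appendNew D x) [] 0 (D.idxOf x) false O)
      (outState B L' (appendNew D x) [] 0 0 false (unary (D.idxOf x) ++ O))
      (3 * D.idxOf x + 2) := by
    refine (pushBlock_runs (by decide) _ _ rfl).of_eq ?_ le_rfl
    funext k
    cases k <;> rfl
  refine (r1.seq (r2.seq (r3.seq (r4.seq r5)))).mono ?_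
  have h1 : D.idxOf x ≤ D.length := List.idxOf_le_length
  have h2 : (appendNew D x).length * (20 * (N + 1)) ≤ (D.length + 1) * (20 * (N + 1)) :=
    Nat.mul_le_mul_right _ (length_appendNew_le D x)
  have h3 : D.length ≤ D.length * (N + 1) := Nat.le_mul_of_pos_right _ (Nat.succ_pos N)
  have h4 : D.length * (20 * (N + 1)) = 20 * (D.length * (N + 1)) := by ring
  have h5 : (D.length + 1) * (20 * (N + 1)) = 20 * (D.length * (N + 1)) + 20 * (N + 1) := by ring
  have h6 : (D.length + 1) * (60 * (N + 1)) = 60 * (D.length * (N + 1)) + 60 * (N + 1) := by ring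
  omega

/-- Renames all variables and writes the constraints. -/
def renumberAll : KProg := loop .lst' .lst' nonemptyTest renumberStep

theorem idxOf_of_prefix {α : Type*} [DecidableEq α] {D D' : List α} (h : D <+: D') {x : α}
    (hx : x ∈ D) : D'.idxOf x = D.idxOf x := by
  obtain ⟨t, rfl⟩ := h
  exact List.idxOf_append_of_mem hx

/-- The dictionary grows only at its end, so a place that has been written out stays valid. -/
theorem idxOf_foldl_appendNew {α : Type*} [DecidableEq α] (l D : List α) (x : α) :
    (l.foldl appendNew (appendNew D x)).idxOf x = D.idxOf x := by
  rw [idxOf_of_prefix (prefix_foldl_appendNew l _) ((mem_appendNew D x x).2 (Or.inr rfl))]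
  unfold appendNew
  split_ifs with h
  · rfl
  · rw [List.idxOf_append_of_notMem h, List.idxOf_eq_length h]
    simp

/-- The output stack is filled from the back, which reverses the order of `l`. This is why
`usedVars` collects the variables from the reversed list. -/
theorem renumberAll_runs (B O : List InstanceSymbol) {N : ℕ} (l D : List ℕ)
    (hl : ∀ a ∈ l, a ≤ N) (hD : ∀ a ∈ D, a ≤ N) (M : ℕ) (hM : D.length + l.length ≤ M) :
    Runs renumberAll (outState B (encNums l) D [] 0 0 false O)
      (outState B [] (l.foldl appendNew D) [] 0 0 false
        (encNums (l.map fun x => (l.foldl appendNew D).idxOf x).reverse ++ O))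
      (l.length * ((M + 1) * (60 * (N + 1)) + 1) + 1) := by
  induction l generalizing D O with
  | nil => exact (Runs.loop_false rfl).of_eq (by simp [encNums]) (by simp)
  | cons x l ih =>
    have hx := hl x (by simp)
    have hlen := length_appendNew_le D x
    rw [List.length_cons] at hM
    have r := ih (unary (D.idxOf x) ++ O) (appendNew D x) (fun a ha => hl a (by simp [ha]))
      (fun a ha => ((mem_appendNew D x a).1 ha).elim (hD a) fun e => e ▸ hx) (by omega)
    refine (Runs.loop_true ?_ (by rw [encNums_cons]; exact renumberStep_runs B _ O hx D hD)
      r).of_eq ?_ ?_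
    · change nonemptyTest (encNums (x :: l)).head? _ = true
      rw [encNums_cons]
      exact isSome_head?_unary_append _ _
    · rw [List.foldl_cons, List.map_cons, List.reverse_cons, encNums_append, List.append_assoc,
        idxOf_foldl_appendNew]
      simp [encNums]
    · have : (D.length + 1) * (60 * (N + 1)) ≤ (M + 1) * (60 * (N + 1)) :=
        Nat.mul_le_mul_right _ (by omega)
      rw [List.length_cons, Nat.succ_mul l.length]
      omega

/-- Writes the number of the variables and the parameter. -/
def writeHeader : KProg :=
  seq (push .out sep) (seq
    (loop .dic .dic nonemptyTest (seq (popBlock .dic .rx) (seq (clear .rx) (push .out one))))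
    (seq (push .out sep) (moveBits .bits .out)))

theorem writeHeader_runs (l : List Bool) (O : List InstanceSymbol) {N : ℕ} (D : List ℕ)
    (hD : ∀ a ∈ D, a ≤ N) :
    Runs writeHeader (outState (l.map ofBool) [] D [] 0 0 false O)
      (outState [] [] [] [] 0 0 false
        (l.reverse.map ofBool ++ (sep :: (unary D.length ++ O))))
      (D.length * (10 * (N + 1)) + 4 * l.length + 4) := by
  have h : ∀ (D : List ℕ) (O : List InstanceSymbol), (∀ a ∈ D, a ≤ N) →
      Runs (loop .dic .dic nonemptyTest (seq (popBlock .dic .rx) (seq (clear .rx) (push .out one))))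
        (outState (l.map ofBool) [] D [] 0 0 false O)
        (outState (l.map ofBool) [] [] [] 0 0 false (ones D.length ++ O))
        (D.length * (10 * (N + 1)) + 1) := by
    intro D
    induction D with
    | nil => exact fun O _ => (Runs.loop_false rfl).of_eq (by simp [ones]) (by simp)
    | cons a D ih =>
      intro O hD
      have ha := hD a (by simp)
      have r : Runs (seq (popBlock .dic .rx) (seq (clear .rx) (push .out one)))
          (outState (l.map ofBool) [] (a :: D) [] 0 0 false O)
          (outState (l.map ofBool) [] D [] 0 0 false (one :: O)) (5 * a + 4) := by
        refine ((popBlock_runs (by decide) a (encNums D) _ (encNums_cons a D) rfl).seq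
          ((clear_runs _ _).seq (Runs.push _ _ _))).of_eq ?_ ?_
        · funext k
          cases k <;> rfl
        · change 3 * a + 2 + (2 * (ones a).length + 1 + 1) ≤ _
          rw [length_ones]
          omega
      refine (Runs.loop_true ?_ r (ih _ fun c hc => hD c (by simp [hc]))).of_eq ?_ ?_
      · change nonemptyTest (encNums (a :: D)).head? _ = true
        rw [encNums_cons]
        exact isSome_head?_unary_append _ _
      · rw [ones_append_cons, List.length_cons, ones_succ, List.cons_append]
      · rw [List.length_cons, Nat.succ_mul D.length]
        omega
  have r1 : Runs (push .out sep) (outState (l.map ofBool) [] D [] 0 0 false O)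
      (outState (l.map ofBool) [] D [] 0 0 false (sep :: O)) 1 := by
    refine (Runs.push _ _ _).of_eq ?_ le_rfl
    funext k
    cases k <;> rfl
  have r3 : Runs (seq (push .out sep) (moveBits .bits .out))
      (outState (l.map ofBool) [] [] [] 0 0 false (ones D.length ++ sep :: O))
      (outState [] [] [] [] 0 0 false (l.reverse.map ofBool ++ (sep :: (unary D.length ++ O))))
      (4 * l.length + 2) := by
    refine ((Runs.push _ _ _).seq (moveBits_runs (by decide) l [] (Or.inl rfl) _
      (List.append_nil _).symm)).of_eq ?_ (by omega)
    rw [unary_eq, List.append_assoc, List.singleton_append]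
    funext k
    cases k <;> rfl
  exact (r1.seq ((h D _ hD).seq r3)).mono (by omega)

end StackProg

section Renaming

variable {α β : Type*} [DecidableEq α] [DecidableEq β]

theorem idxOf_map_of_injective {f : α → β} (hf : Function.Injective f) (D : List α) (x : α) :
    (D.map f).idxOf (f x) = D.idxOf x := by
  induction D with
  | nil => rfl
  | cons a D ih =>
    rw [List.map_cons, List.idxOf_cons, List.idxOf_cons, ih]
    by_cases h : a = x
    · simp [h]
    · have h' : f a ≠ f x := fun e => h (hf e)
      simp [beq_eq_false_iff_ne.2 h, beq_eq_false_iff_ne.2 h']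

/-- Used with `Fin.val`: the machine handles plain numbers, while `usedVars` consists of elements of
`Fin n`. -/
theorem foldl_appendNew_map {f : α → β} (hf : Function.Injective f) (l D : List α) :
    (l.map f).foldl appendNew (D.map f) = (l.foldl appendNew D).map f := by
  induction l generalizing D with
  | nil => rfl
  | cons x l ih =>
    rw [List.map_cons, List.foldl_cons, List.foldl_cons, ← ih]
    congr 1
    simp only [appendNew, List.mem_map_of_injective hf]
    split_ifs <;> simp

end Renaming

/-! ### The complete program and its running time. -/

namespace StackProg

open InstanceSymbol Function BetweennessConstraint

theorem length_encNums_le {N : ℕ} (l : List ℕ) (hl : ∀ a ∈ l, a ≤ N) :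
    (encNums l).length ≤ l.length * (N + 1) := by
  induction l with
  | nil => simp [encNums]
  | cons a l ih =>
    have ha := hl a (by simp)
    have := ih fun b hb => hl b (by simp [hb])
    rw [encNums_cons, List.length_append, List.length_cons, Nat.succ_mul l.length, unary_eq,
      List.length_append, length_ones, List.length_singleton]
    omega

theorem flatMap_encode_pmap_rename {n : ℕ} (D : List (Fin n)) (L : List (BetweennessConstraint n))
    (h : ∀ c ∈ L, c.mid ∈ D ∧ c.left ∈ D ∧ c.right ∈ D) :
    (L.pmap (rename D) h).flatMap BetweennessConstraint.encode =
      encNums ((flatVars L).map fun x => D.idxOf x) := by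
  induction L with
  | nil => rfl
  | cons c L ih =>
    rw [List.pmap_cons, List.flatMap_cons, ih]
    simp [flatVars, encNums, BetweennessConstraint.encode, rename]

/-- Counts the numbers of `lst` and compares the square of `2 ^ 15` times the parameter with
their number. -/
def compareThreshold : KProg :=
  seq countNums (seq evalBits (seq (rep (appendDigit false) 15) (seq (moveBits .bits' .bits)
    (seq squareVal compareSquare))))

/-- The numbers counted are the entries of the constraints, three for each, hence the `3 * length`
in the threshold; the factor `2 ^ 15` costs fifteen doublings. -/
theorem compareThreshold_runs (κ : ℕ) (l : List ℕ) {N P : ℕ} (hl : ∀ a ∈ l, a ≤ N)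
    (hN : N + 1 ≤ P) (hlen : l.length + 1 ≤ P) (hκ : (Computability.encodeNat κ).length + 1 ≤ P) :
    Runs compareThreshold
      (arithState ((Computability.encodeNat κ).reverse.map ofBool) [] (encNums l) [] 0 0 0 0)
      (arithState ((Computability.encodeNat κ).reverse.map ofBool) [] [] (encNums l.reverse) 0 0 0
        (min (2 ^ 15 * κ) (l.length + 1) * min (2 ^ 15 * κ) (l.length + 1) - l.length))
      (1500 * P ^ 3) := by
  set e := Computability.encodeNat κ with he
  set m := l.length with hm
  set v := min (2 ^ 15 * κ) (m + 1) with hv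
  have r1 : Runs countNums (arithState (e.reverse.map ofBool) [] (encNums l) [] 0 0 0 0)
      (arithState (e.reverse.map ofBool) [] [] (encNums l.reverse) m 0 0 0)
      (m * (6 * (N + 1)) + 1) := by
    have h := countNums_runs (e.reverse.map ofBool) N l [] 0 hl
    rwa [List.append_nil, Nat.zero_add] at h
  have r2 := evalBits_runs e.reverse [] [] (encNums l.reverse) m 0 0 0 (Nat.zero_le _)
  rw [foldl_saturate, foldr_encodeNat, List.reverse_reverse, List.append_nil,
    List.length_reverse] at r2
  have r3 := rep_appendDigit_runs 15 [] (e.map ofBool) [] (encNums l.reverse) m κ 0 0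
  rw [← hv] at r3
  have r4 : Runs (moveBits .bits' .bits)
      (arithState [] (e.map ofBool) [] (encNums l.reverse) m v 0 0)
      (arithState (e.reverse.map ofBool) [] [] (encNums l.reverse) m v 0 0)
      (4 * e.length + 1) := by
    refine (moveBits_runs (by decide) e [] (Or.inl rfl) _ (List.append_nil _).symm).of_eq ?_ le_rfl
    funext k
    cases k <;> first | rfl | exact List.append_nil _
  have r5 := squareVal_runs (e.reverse.map ofBool) [] [] (encNums l.reverse) m v
  have r6 := compareSquare_runs (e.reverse.map ofBool) (encNums l.reverse) m v (v * v)
  refine (r1.seq (r2.seq (r3.seq (r4.seq (r5.seq r6))))).mono ?_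
  have hvP : v ≤ P := (min_le_right _ _).trans hlen
  have h1 : m * (6 * (N + 1)) ≤ P * (6 * P) :=
    Nat.mul_le_mul (by omega) (Nat.mul_le_mul_left _ hN)
  have h2 : e.length * (90 * (m + 1)) ≤ P * (90 * P) :=
    Nat.mul_le_mul (by omega) (Nat.mul_le_mul_left _ hlen)
  have h3 : v * v ≤ P * P := Nat.mul_le_mul hvP hvP
  have h4 : 10 * (v + 1) ^ 2 = 10 * (v * v) + 20 * v + 10 := by ring
  have hP : 1 ≤ P := by omega
  have h5 : P ≤ P * P := Nat.le_mul_of_pos_left _ hP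
  have h6 : P * P ≤ P ^ 3 := by
    rw [pow_succ, pow_two]
    exact Nat.le_mul_of_pos_right _ hP
  have h7 : P * (6 * P) = 6 * (P * P) := by ring
  have h8 : P * (90 * P) = 90 * (P * P) := by ring
  rw [h4]
  omega

/-- Writes an instance without variables. -/
def writeYes : KProg :=
  seq (clear .bits) (seq (clear .lst') (seq (push .out sep) (push .out sep)))

theorem writeYes_runs (B L' : List InstanceSymbol) :
    Runs writeYes (arithState B [] [] L' 0 0 0 0) (update (fun _ => []) KStack.out [sep, sep])
      (2 * B.length + 2 * L'.length + 4) := by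
  refine ((clear_runs _ _).seq ((clear_runs _ _).seq
    ((Runs.push _ _ _).seq (Runs.push _ _ _)))).of_eq ?_ ?_
  · funext k
    cases k <;> rfl
  · change 2 * B.length + 1 + (2 * L'.length + 1 + (1 + 1)) ≤ _
    omega

/-- Writes the instance without superfluous variables. -/
def writeCompressed : KProg := seq (clear .prod) (seq renumberAll writeHeader)

theorem writeCompressed_runs {n : ℕ} (L : List (BetweennessConstraint n)) (κ p : ℕ) :
    Runs writeCompressed
      (arithState ((Computability.encodeNat κ).reverse.map ofBool) [] []
        (encNums ((flatVars L).map Fin.val).reverse) 0 0 0 p)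
      (update (fun _ => []) KStack.out (encodeBetweennessAA (compress L, κ)))
      (2 * p + 3 * L.length * ((3 * L.length + 1) * (60 * (n + 1)) + 1) +
        3 * L.length * (10 * (n + 1)) + 4 * (Computability.encodeNat κ).length + 6) := by
  set e := Computability.encodeNat κ with he
  have hval : ∀ (l : List (Fin n)), ∀ a ∈ l.map Fin.val, a ≤ n := by
    intro l a ha
    obtain ⟨x, -, rfl⟩ := List.mem_map.1 ha
    exact x.isLt.le
  have hD : ((flatVars L).reverse.map Fin.val).foldl appendNew [] = (usedVars L).map Fin.val :=
    foldl_appendNew_map Fin.val_injective (flatVars L).reverse []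
  have hDlen : (usedVars L).length ≤ 3 * L.length := by
    have := length_foldl_appendNew_le (flatVars L).reverse []
    rw [List.length_reverse, length_flatVars] at this
    exact this.trans (by simp)
  have r1 : Runs (clear .prod)
      (arithState (e.reverse.map ofBool) [] [] (encNums ((flatVars L).map Fin.val).reverse) 0 0 0 p)
      (outState (e.reverse.map ofBool) (encNums ((flatVars L).reverse.map Fin.val)) [] [] 0 0 false
        []) (2 * p + 1) := by
    refine (clear_runs _ _).of_eq ?_ ?_
    · rw [← List.map_reverse (l := flatVars L)]
      funext k
      cases k <;> rfl
    · change 2 * (ones p).length + 1 ≤ _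
      rw [length_ones]
  have r2 := renumberAll_runs (e.reverse.map ofBool) [] ((flatVars L).reverse.map Fin.val) []
    (hval _) (by simp) (3 * L.length) (by simp [length_flatVars])
  have r3 := writeHeader_runs e.reverse
    (encNums ((flatVars L).map fun x => (usedVars L).idxOf x)) ((usedVars L).map Fin.val) (hval _)
  have hout : (((flatVars L).reverse.map Fin.val).map fun x =>
      ((usedVars L).map Fin.val).idxOf x).reverse =
      (flatVars L).map fun x => (usedVars L).idxOf x := by
    rw [List.map_map, ← List.map_reverse, List.reverse_reverse]
    exact List.map_congr_left fun x _ => idxOf_map_of_injective Fin.val_injective _ x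
  rw [hD, hout, List.append_nil, List.length_map, List.length_reverse, length_flatVars] at r2
  rw [List.reverse_reverse, List.length_map, List.length_reverse] at r3
  refine (r1.seq (r2.seq r3)).of_eq ?_ ?_
  · have : encodeBetweennessAA (compress L, κ) = e.map ofBool ++ (sep ::
        (unary (usedVars L).length ++ encNums ((flatVars L).map fun x => (usedVars L).idxOf x))) := by
      rw [← flatMap_encode_pmap_rename (usedVars L) L fun _ hc => mem_usedVars hc]
      simp [encodeBetweennessAA, compress, he]
    rw [this]
    funext k
    cases k <;> rfl
  · have := Nat.mul_le_mul_right (10 * (n + 1)) hDlen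
    omega

/-- The program that computes `kernelize`. -/
def kernelProg : KProg :=
  seq readHeader (seq insertAll (seq compareThreshold
    (ite .prod .prod emptyTest writeYes writeCompressed)))

/-- If truncation changes `a`, then already `(m + 1)²` exceeds `m`. -/
theorem min_mul_min_le_iff (a m : ℕ) : min a (m + 1) * min a (m + 1) ≤ m ↔ a ^ 2 ≤ m := by
  rcases le_total a (m + 1) with h | h
  · rw [min_eq_left h, pow_two]
  · rw [min_eq_right h, pow_two]
    have h1 : (m + 1) * (m + 1) ≤ a * a := Nat.mul_le_mul h h
    have h2 : m + 1 ≤ (m + 1) * (m + 1) := Nat.le_mul_of_pos_left _ (Nat.succ_pos m)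
    omega

/-- The number of variables, of constraint entries and of digits of `κ` are all at most `P`, and no
phase costs more than the number of entries times the dictionary or list length times the size of an
index. This makes the total cubic. -/
theorem kernelProg_runs (p : BetweennessInstance × ℕ) :
    Runs kernelProg (update (fun _ => []) KStack.inp (encodeBetweennessAA p))
      (update (fun _ => []) KStack.out (encodeBetweennessAA (kernelize p)))
      (2000 * ((encodeBetweennessAA p).length + 1) ^ 3) := by
  obtain ⟨⟨n, Cs⟩, κ⟩ := p
  set e := Computability.encodeNat κ with he
  set L := cancel Cs with hL
  set l := (flatVars L).map Fin.val with hl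
  set P := (encodeBetweennessAA (⟨n, Cs⟩, κ)).length + 1 with hP
  have henc : encodeBetweennessAA (⟨n, Cs⟩, κ) = e.map ofBool ++ (sep :: (unary n ++ encCs Cs)) := by
    simp [encodeBetweennessAA, encCs, he]
  have hl_le : ∀ a ∈ l, a ≤ n := by
    intro a ha
    obtain ⟨x, -, rfl⟩ := List.mem_map.1 ha
    exact x.isLt.le
  have hl_len : l.length = 3 * L.length := by rw [hl, List.length_map, length_flatVars]
  have hLCs : L.length ≤ Cs.length := by
    obtain ⟨k, h, -⟩ := foldl_insertCancel_count Cs []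
    change L.length + 3 * k = _ at h
    simp only [List.length_nil, zero_add] at h
    omega
  have hCs : 3 * Cs.length ≤ (encCs Cs).length := by
    have : ∀ l : List ℕ, l.length ≤ (encNums l).length := by
      intro l
      induction l with
      | nil => simp
      | cons a l ih =>
        rw [encNums_cons, List.length_append, List.length_cons, unary_eq, List.length_append,
          List.length_singleton]
        omega
    have h := this ((flatVars Cs).map Fin.val)
    rwa [← encCs_eq_encNums, List.length_map, length_flatVars] at h
  have hPe : P = e.length + n + (encCs Cs).length + 3 := by
    rw [hP, henc, unary_eq]
    simp only [List.length_append, List.length_map, List.length_cons, length_ones,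
      List.length_nil]
    omega
  have r1 : Runs readHeader (update (fun _ => []) KStack.inp (encodeBetweennessAA (⟨n, Cs⟩, κ)))
      (listState (encCs Cs) (e.reverse.map ofBool) [] []) (4 * e.length + 5 * n + 5) := by
    have hs : update (fun _ => []) KStack.inp (encodeBetweennessAA (⟨n, Cs⟩, κ)) =
        listState (e.map ofBool ++ (sep :: (unary n ++ encCs Cs))) [] [] [] := by
      rw [henc]
      funext k
      cases k <;> rfl
    rw [hs]
    exact readHeader_runs e n (encCs Cs)
  have r2 : Runs insertAll (listState (encCs Cs) (e.reverse.map ofBool) [] [])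
      (arithState (e.reverse.map ofBool) [] (encNums l) [] 0 0 0 0)
      (Cs.length * ((Cs.length + 1) * (200 * (n + 1)) + 1) + 1) := by
    refine (insertAll_runs (e.reverse.map ofBool) Cs [] Cs.length (by simp)).of_eq ?_ le_rfl
    change listState [] _ (encCs L) [] = _
    rw [encCs_eq_encNums]
    funext k
    cases k <;> rfl
  have r3 := compareThreshold_runs κ l (P := P) hl_le (by omega) (by omega)
    (by rw [← he]; omega)
  rw [hl_len] at r3
  set v := min (2 ^ 15 * κ) (3 * L.length + 1) with hv
  have hiff : v * v ≤ 3 * L.length ↔ (2 ^ 15 * κ) ^ 2 ≤ 3 * L.length := min_mul_min_le_iff _ _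
  have hP1 : P * P * P = P ^ 3 := by ring
  have hP2 : P * P ≤ P ^ 3 := hP1 ▸ Nat.le_mul_of_pos_right _ (by omega)
  have hP3 : P ≤ P * P := Nat.le_mul_of_pos_left _ (by omega)
  have hvv : v * v ≤ P * P := Nat.mul_le_mul (by omega) (by omega)
  have r4 : Runs (ite .prod .prod emptyTest writeYes writeCompressed)
      (arithState (e.reverse.map ofBool) [] [] (encNums l.reverse) 0 0 0
        (v * v - 3 * L.length))
      (update (fun _ => []) KStack.out (encodeBetweennessAA (kernelize (⟨n, Cs⟩, κ))))
      (100 * P ^ 3) := by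
    by_cases h : (2 ^ 15 * κ) ^ 2 ≤ 3 * L.length
    · have hk : kernelize (⟨n, Cs⟩, κ) = (⟨0, []⟩, 0) := if_pos h
      rw [hk, Nat.sub_eq_zero_of_le (hiff.2 h)]
      refine (Runs.ite_true rfl (writeYes_runs _ _)).mono ?_
      have h1 := length_encNums_le l.reverse (N := n) (by simpa using hl_le)
      have h2 : l.reverse.length * (n + 1) ≤ P * P :=
        Nat.mul_le_mul (by rw [List.length_reverse]; omega) (by omega)
      rw [List.length_map, List.length_reverse]
      omega
    · have hk : kernelize (⟨n, Cs⟩, κ) = (compress L, κ) := if_neg h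
      rw [hk]
      obtain ⟨d, hd⟩ : ∃ d, v * v - 3 * L.length = d + 1 :=
        ⟨v * v - 3 * L.length - 1, by have := mt hiff.1 h; omega⟩
      rw [hd]
      refine (Runs.ite_false rfl (writeCompressed_runs L κ (d + 1))).mono ?_
      have h1 : 3 * L.length * ((3 * L.length + 1) * (60 * (n + 1)) + 1) ≤
          P * (P * (60 * P) + 1) := by
        gcongr <;> omega
      have h2 : 3 * L.length * (10 * (n + 1)) ≤ P * (10 * P) := by
        gcongr <;> omega
      have h3 : P * (P * (60 * P) + 1) = 60 * P ^ 3 + P := by ring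
      have h4 : P * (10 * P) = 10 * (P * P) := by ring
      rw [h3] at h1
      rw [h4] at h2
      rw [← he]
      omega
  refine (r1.seq (r2.seq (r3.seq r4))).mono ?_
  have h1 : Cs.length * ((Cs.length + 1) * (200 * (n + 1)) + 1) ≤ P * (P * (200 * P) + 1) := by
    gcongr <;> omega
  have h2 : P * (P * (200 * P) + 1) = 200 * P ^ 3 + P := by ring
  rw [h2] at h1
  omega

end StackProg

theorem kernelize_computableInPolyTime :
    Nonempty (Turing.TM2ComputableInPolyTime encodeBetweennessAA encodeBetweennessAA kernelize) :=
  StackProg.nonempty_computableInPolyTime StackProg.kernelProg .inp .out encodeBetweennessAA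
    encodeBetweennessAA kernelize (Polynomial.C 2000 * (Polynomial.X + 1) ^ 3) fun p => by
      simpa using StackProg.kernelProg_runs p

theorem mainTheorem4 :
    ∃ (R : BetweennessInstance × ℕ → BetweennessInstance × ℕ) (f g : ℕ → ℕ),
      IsKernelization encodeBetweennessAA BetweennessInstance.size BetweennessAA R f g ∧
        ∃ c : ℕ, ∀ κ : ℕ, g κ ≤ c * κ ^ 2 :=
  ⟨kernelize, id, fun κ => 2 ^ 31 * κ ^ 2,
    { polyTime := kernelize_computableInPolyTime
      mem_iff := kernelize_mem_iff
      param_le := kernelize_param_le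
      size_le := kernelize_size_le }, 2 ^ 31, fun _ => le_rfl⟩
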